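/- Let $M$ be a smooth (Hausdorff, second countable) manifold of dimension $n$ and $x_0\in M$. For a vector space $V$ write $V((\nu))$ for the formal Laurent series in $\nu$ with coefficients in $V$; functions are smooth and complex-valued, $C^\infty(M)=C^\infty(M,\mathbb C)$. Let $\varphi=\nu^{-1}\varphi_{-1}+\varphi_0+\nu\varphi_1+\dots\in C^\infty(M)((\nu))$ be a formal phase function at $x_0$, which means that $x_0$ is a nondegenerate critical point of $\varphi_{-1}$ (the complex Hessian matrix of $\varphi_{-1}$ at $x_0$ is invertible) with zero critical value $\varphi_{-1}(x_0)=0$. Let $\rho=\rho_0+\nu\rho_1+\dots$ be a formal volume form, that is, a formal power series of smooth complex-valued $n$-forms on $M$, such that $\rho_0$ does not vanish at $x_0$. A formal distribution supported at $x_0$ is a series $\Lambda=\Lambda_0+\nu\Lambda_1+\dots$ of distributions $\Lambda_r$ on $M$ supported at $x_0$; it acts $\nu$-linearly by $\Lambda\big(\sum_s\nu^sf_s\big)=\sum_k\nu^k\sum_{r+s=k}\Lambda_r(f_s)\in\mathbb C((\nu))$ on $f=\sum_s\nu^sf_s\in C^\infty(M)((\nu))$, and it can be applied to formal functions that are defined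 only near $x_0$. It is called a formal oscillatory integral (FOI) at $x_0$ associated with $(\varphi,\rho)$ if $\Lambda_0\neq0$ and $$\Lambda\big(vf+(v\varphi+\mathrm{div}_\rho v)f\big)=0$$ for all vector fields $v$ on $M$ and all $f\in C^\infty(M)((\nu))$, where $\mathrm{div}_\rho v=(\mathbb L_v\rho)/\rho$ near $x_0$ and $\mathbb L_v$ is the Lie derivative. It is strongly associated with $(\varphi,\rho)$ if it is associated with $(\varphi,\rho)$ and moreover $$\frac{d}{d\nu}\Lambda(f)-\Lambda\left(\frac{df}{d\nu}+\Big(\frac{d\varphi}{d\nu}+\frac{du}{d\nu}-\frac{n}{2\nu}\Big)f\right)=0$$ for all $f\in C^\infty(M)((\nu))$, where $\rho=e^{u}\,dx^1\wedge\dots\wedge dx^n$ in local coordinates near $x_0$, so that $\frac{du}{d\nu}=\frac{d\rho}{d\nu}\big/\rho$ does not depend on the coordinates. Then: 1. There exists a FOI $\Lambda$ at $x_0$ strongly associated with $(\varphi,\rho)$. 2. It is determined up to a nonzero multiplicative constant from $\mathbb C$: if $\Lambda$ is a FOI strongly associated with $(\varphi,\rho)$, then the FOIs strongly associated with $(\varphi,\rho)$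 are exactly the $c\Lambda$ with $c\in\mathbb C$, $c\neq0$. 3. There is a unique FOI $\Lambda$ strongly associated with $(\varphi,\rho)$ whose leading term is the Dirac distribution, $\Lambda_0=\delta_{x_0}$. 4. If a FOI $\Lambda$ strongly associated with $(\varphi,\rho)$ is also strongly associated with $(\hat\varphi,\rho)$, where $\hat\varphi=\nu^{-1}\hat\varphi_{-1}+\hat\varphi_0+\dots$ is another formal phase function at $x_0$, then the full jet of $\varphi-\hat\varphi$ at $x_0$ is a constant from $\mathbb C$: there is $c\in\mathbb C$ such that for every power of $\nu$ the coefficient of $\varphi-\hat\varphi-c$ has vanishing full jet at $x_0$. -/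

import Mathlib

open scoped Manifold ContDiff Topology LaurentSeries

noncomputable section

namespace FOI

/-- The `ℂ`-algebra `C^∞(M)` of smooth complex-valued functions on a manifold `M` of dimension
`n`. -/
def SmoothFun (n : ℕ) (M : Type*) [TopologicalSpace M]
    [ChartedSpace (EuclideanSpace ℝ (Fin n)) M] : Subalgebra ℂ (M → ℂ) where
  carrier := {f | ContMDiff (𝓡 n) 𝓘(ℝ, ℂ) ∞ f}
  mul_mem' ha hb :=
    (contDiff_mul (𝕜 := ℝ) (𝔸 := ℂ)).contMDiff.comp (ContMDiff.prodMk_space ha hb)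
  add_mem' ha hb := (contDiff_add (𝕜 := ℝ) (F := ℂ)).contMDiff.comp (ContMDiff.prodMk_space ha hb)
  algebraMap_mem' _ := contMDiff_const

/-- Smooth (real) vector fields on `M`, as smooth sections of the tangent bundle. -/
abbrev SmoothVF (n : ℕ) (M : Type*) [TopologicalSpace M]
    [ChartedSpace (EuclideanSpace ℝ (Fin n)) M] [IsManifold (𝓡 n) ∞ M] :=
  Cₛ^∞⟮𝓡 n; EuclideanSpace ℝ (Fin n), (TangentSpace (𝓡 n) : M → Type _)⟯

/-- Smooth complex-valued differential forms of top degree `n` on `M`: an alternating form on each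
tangent space whose values on smooth vector fields are smooth functions. -/
structure TopForm (n : ℕ) (M : Type*) [TopologicalSpace M]
    [ChartedSpace (EuclideanSpace ℝ (Fin n)) M] [IsManifold (𝓡 n) ∞ M] where
  form : ∀ x : M, (TangentSpace (𝓡 n) x) [⋀^Fin n]→ₗ[ℝ] ℂ
  smooth : ∀ w : Fin n → SmoothVF n M,
    ContMDiff (𝓡 n) 𝓘(ℝ, ℂ) ∞ (fun x => form x (fun i => w i x))

/-- A formal distribution `Λ = Λ₀ + ν Λ₁ + …`, given by its components; the conditions on the
components are in `IsPointDistribution`. -/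
abbrev FormalFunctional (n : ℕ) (M : Type*) [TopologicalSpace M]
    [ChartedSpace (EuclideanSpace ℝ (Fin n)) M] :=
  ℕ → (SmoothFun n M →ₗ[ℂ] ℂ)

section
variable {n : ℕ} {M : Type*} [TopologicalSpace M] [ChartedSpace (EuclideanSpace ℝ (Fin n)) M]

/-- The function `f` read in the preferred chart at `x₀`. -/
def inChart (x₀ : M) (f : M → ℂ) : EuclideanSpace ℝ (Fin n) → ℂ :=
  fun y => f ((extChartAt (𝓡 n) x₀).symm y)

/-- The full jet of `f` at `x₀` is zero: all the partial derivatives of `f`, of all orders `≥ 0`,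
vanish at `x₀`. -/
def JetVanishes (x₀ : M) (f : SmoothFun n M) : Prop :=
  ∀ m : ℕ, iteratedFDeriv ℝ m (inChart (n := n) x₀ f) (extChartAt (𝓡 n) x₀ x₀) = 0

/-- The Hessian matrix of `f` at `x₀` in the preferred chart. -/
def hessian (x₀ : M) (f : SmoothFun n M) : Matrix (Fin n) (Fin n) ℂ :=
  Matrix.of fun k l =>
    fderiv ℝ (fderiv ℝ (inChart (n := n) x₀ f)) (extChartAt (𝓡 n) x₀ x₀)
      (EuclideanSpace.single k 1) (EuclideanSpace.single l 1)

/-- `x₀` is a nondegenerate critical point of `f`. -/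
def IsNondegenerateCritical (x₀ : M) (f : SmoothFun n M) : Prop :=
  mfderiv (𝓡 n) 𝓘(ℝ, ℂ) (f : M → ℂ) x₀ = 0 ∧ IsUnit (hessian x₀ f).det

/-- `φ = ν⁻¹ φ₋₁ + φ₀ + …`, where `x₀` is a nondegenerate critical point of `φ₋₁` with zero
critical value. -/
structure IsFormalPhase (x₀ : M) (φ : LaurentSeries (SmoothFun n M)) : Prop where
  coeff_eq_zero : ∀ k : ℤ, k < -1 → φ.coeff k = 0
  critical : IsNondegenerateCritical x₀ (φ.coeff (-1))
  critical_value : (φ.coeff (-1) : M → ℂ) x₀ = 0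

/-- A distribution on `M` supported at `x₀`: a linear functional which vanishes on the functions
vanishing near `x₀`, and which is continuous, that is, dominated by the maximum of finitely many
derivatives on a compact set (for a functional supported at `x₀` one chart around `x₀` is
enough). -/
structure IsPointDistribution (x₀ : M) (L : SmoothFun n M →ₗ[ℂ] ℂ) : Prop where
  support : ∀ f : SmoothFun n M, (∀ᶠ x in 𝓝 x₀, (f : M → ℂ) x = 0) → L f = 0
  continuous : ∃ (K : Set (EuclideanSpace ℝ (Fin n))) (N : ℕ) (C : ℝ),
    IsCompact K ∧ K ⊆ (extChartAt (𝓡 n) x₀).target ∧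
    ∀ (f : SmoothFun n M) (B : ℝ), 0 ≤ B →
      (∀ m ≤ N, ∀ y ∈ K, ‖iteratedFDeriv ℝ m (inChart (n := n) x₀ f) y‖ ≤ B) → ‖L f‖ ≤ C * B

/-- The Dirac distribution at `x₀`. -/
def dirac (x₀ : M) : SmoothFun n M →ₗ[ℂ] ℂ where
  toFun f := (f : M → ℂ) x₀
  map_add' _ _ := rfl
  map_smul' _ _ := rfl

/-- The coefficient of `Λ(f)` at `ν^k` is a sum of finitely many terms. -/
theorem finite_support_act (Λ : FormalFunctional n M) (f : LaurentSeries (SmoothFun n M))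
    (k : ℤ) : (Function.support fun r : ℕ => Λ r (f.coeff (k - r))).Finite := by
  refine (Set.finite_le_nat (k - f.order).toNat).subset fun r hr => ?_
  by_contra h
  simp only [Set.mem_ofPred_eq, not_le] at h
  refine hr ?_
  have : k - (r : ℤ) < f.order := by omega
  simp [HahnSeries.coeff_eq_zero_of_lt_order this]

/-- The `ν`-linear action of `Λ = Λ₀ + ν Λ₁ + …` on formal functions:
the coefficient of `Λ(f)` at `ν^k` is `∑ Λ_r(f_{k-r})`. -/
def act (Λ : FormalFunctional n M) (f : LaurentSeries (SmoothFun n M)) : LaurentSeries ℂ :=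
  HahnSeries.ofSuppBddBelow (fun k : ℤ => ∑ᶠ r : ℕ, Λ r (f.coeff (k - r))) <| by
    refine ⟨f.order, fun k hk => ?_⟩
    by_contra h
    refine hk (finsum_eq_zero_of_forall_eq_zero fun r => ?_)
    have : k - (r : ℤ) < f.order := by omega
    simp [HahnSeries.coeff_eq_zero_of_lt_order this]

/-- The formal constant `n / (2ν)`. -/
def halfDimOverNu (n : ℕ) (M : Type*) [TopologicalSpace M]
    [ChartedSpace (EuclideanSpace ℝ (Fin n)) M] : LaurentSeries (SmoothFun n M) :=
  HahnSeries.single (-1) (algebraMap ℂ (SmoothFun n M) ((n : ℂ) / 2))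

variable [IsManifold (𝓡 n) ∞ M]

theorem contMDiff_vfApply (v : SmoothVF n M) (f : SmoothFun n M) :
    ContMDiff (𝓡 n) 𝓘(ℝ, ℂ) ∞
      (fun x => (mfderiv (𝓡 n) 𝓘(ℝ, ℂ) (f : M → ℂ) x (v x) : ℂ)) := by
  have h1 : ContMDiff (𝓡 n).tangent 𝓘(ℝ, ℂ).tangent ∞
      (tangentMap (𝓡 n) 𝓘(ℝ, ℂ) (f : M → ℂ)) :=
    ContMDiff.contMDiff_tangentMap (n := ∞) f.2 (by simp)
  exact (contMDiff_snd_tangentBundle_modelSpace ℂ 𝓘(ℝ, ℂ)).comp (h1.comp v.contMDiff_toFun)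

/-- The derivative `v f` of a smooth function along a vector field. -/
def vfApply (v : SmoothVF n M) : SmoothFun n M →+ SmoothFun n M where
  toFun f := ⟨fun x => mfderiv (𝓡 n) 𝓘(ℝ, ℂ) (f : M → ℂ) x (v x), contMDiff_vfApply v f⟩
  map_zero' := by
    ext x
    change mfderiv (𝓡 n) 𝓘(ℝ, ℂ) (fun _ : M => (0 : ℂ)) x (v x) = 0
    rw [mfderiv_const]; rfl
  map_add' f g := by
    ext x
    have hf : MDifferentiableAt (𝓡 n) 𝓘(ℝ, ℂ) (f : M → ℂ) x :=
      (show ContMDiff (𝓡 n) 𝓘(ℝ, ℂ) ∞ (f : M → ℂ) from f.2).mdifferentiable (by simp) x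
    have hg : MDifferentiableAt (𝓡 n) 𝓘(ℝ, ℂ) (g : M → ℂ) x :=
      (show ContMDiff (𝓡 n) 𝓘(ℝ, ℂ) ∞ (g : M → ℂ) from g.2).mdifferentiable (by simp) x
    change mfderiv (𝓡 n) 𝓘(ℝ, ℂ) ((f : M → ℂ) + (g : M → ℂ)) x (v x) = _
    rw [mfderiv_add hf hg]; rfl

/-- The derivative `v f` of a formal function along a vector field, coefficient by coefficient. -/
def vfApplyFormal (v : SmoothVF n M) (f : LaurentSeries (SmoothFun n M)) :
    LaurentSeries (SmoothFun n M) :=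
  HahnSeries.map f (vfApply v)

/-- The value at `x` of `(𝕃_v σ)(w₁, …, wₙ)`, where `𝕃_v σ` is the Lie derivative of the top form
`σ`: `(𝕃_v σ)(w₁, …, wₙ) = v (σ(w₁, …, wₙ)) - ∑ᵢ σ(w₁, …, [v, wᵢ], …, wₙ)`. -/
def lieDeriv (v : SmoothVF n M) (σ : TopForm n M) (w : Fin n → SmoothVF n M) (x : M) : ℂ :=
  (vfApply v ⟨fun y => σ.form y (fun i => w i y), σ.smooth w⟩ : M → ℂ) x
    - ∑ i, σ.form x (Function.update (fun j => w j x) i (VectorField.mlieBracket (𝓡 n) v (w i) x))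

/-- The formal function `g = g₀ + ν g₁ + …` represents near `x₀` the divergence
`div_ρ v = (𝕃_v ρ) / ρ` with respect to `ρ = ρ₀ + ν ρ₁ + …`, that is, `g ρ = 𝕃_v ρ` on a
neighbourhood of `x₀` (the same for all powers of `ν`). -/
def IsDivergence (x₀ : M) (ρ : ℕ → TopForm n M) (v : SmoothVF n M)
    (g : PowerSeries (SmoothFun n M)) : Prop :=
  ∀ᶠ x in 𝓝 x₀, ∀ (k : ℕ) (w : Fin n → SmoothVF n M),
    ∑ p ∈ Finset.HasAntidiagonal.antidiagonal k,
      ((PowerSeries.coeff p.1 g : SmoothFun n M) : M → ℂ) x * (ρ p.2).form x (fun i => w i x)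
        = lieDeriv v (ρ k) w x

/-- The formal function `g = g₀ + ν g₁ + …` represents near `x₀` the logarithmic derivative
`(dρ/dν) / ρ` of `ρ = ρ₀ + ν ρ₁ + …`, that is, `g ρ = dρ/dν` on a neighbourhood of `x₀`. If
`ρ = e^u dx¹ ∧ … ∧ dxⁿ` in local coordinates, then `dρ/dν = (du/dν) ρ`, so that `g` represents
`du/dν`. -/
def IsLogDerivative (x₀ : M) (ρ : ℕ → TopForm n M) (g : PowerSeries (SmoothFun n M)) : Prop :=
  ∀ᶠ x in 𝓝 x₀, ∀ k : ℕ,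
    ∑ p ∈ Finset.HasAntidiagonal.antidiagonal k, ((PowerSeries.coeff p.1 g : SmoothFun n M) : M → ℂ) x • (ρ p.2).form x
      = ((k : ℂ) + 1) • (ρ (k + 1)).form x

/-- `Λ = Λ₀ + ν Λ₁ + …` is a formal oscillatory integral at `x₀` associated with `(φ, ρ)`:
a formal distribution supported at `x₀` with `Λ₀ ≠ 0` and `Λ(v f + (v φ + div_ρ v) f) = 0` for all
vector fields `v` and all formal functions `f`. Since `Λ` is supported at `x₀`, and `div_ρ v` is
only defined where `ρ₀ ≠ 0`, it enters through its representatives near `x₀`. -/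
structure IsFOI (x₀ : M) (φ : LaurentSeries (SmoothFun n M)) (ρ : ℕ → TopForm n M)
    (Λ : FormalFunctional n M) : Prop where
  distribution : ∀ r, IsPointDistribution x₀ (Λ r)
  leading_ne_zero : Λ 0 ≠ 0
  integration_by_parts : ∀ (v : SmoothVF n M) (g : PowerSeries (SmoothFun n M)),
    IsDivergence x₀ ρ v g → ∀ f : LaurentSeries (SmoothFun n M),
      act Λ (vfApplyFormal v f + (vfApplyFormal v φ + HahnSeries.ofPowerSeries ℤ _ g) * f) = 0

/-- The FOI `Λ` is strongly associated with `(φ, ρ)`: it is associated with `(φ, ρ)` and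
`d/dν Λ(f) - Λ(df/dν + (d(φ + u)/dν - n/(2ν)) f) = 0` for all formal functions `f`, where
`ρ = e^u dx¹ ∧ … ∧ dxⁿ` near `x₀`. -/
structure IsStrongFOI (x₀ : M) (φ : LaurentSeries (SmoothFun n M)) (ρ : ℕ → TopForm n M)
    (Λ : FormalFunctional n M) : Prop extends IsFOI x₀ φ ρ Λ where
  differentiation : ∀ g : PowerSeries (SmoothFun n M), IsLogDerivative x₀ ρ g →
    ∀ f : LaurentSeries (SmoothFun n M),
      LaurentSeries.derivative ℂ (act Λ f)
        - act Λ (LaurentSeries.derivative ℂ f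
            + (LaurentSeries.derivative ℂ φ + HahnSeries.ofPowerSeries ℤ _ g
                - halfDimOverNu n M) * f) = 0

/-- The full jet of the formal function `ψ` at `x₀` is the constant `c ∈ ℂ` (placed at `ν⁰`). -/
def JetIsConst (x₀ : M) (ψ : LaurentSeries (SmoothFun n M)) (c : ℂ) : Prop :=
  ∀ k : ℤ, JetVanishes x₀ ((ψ - HahnSeries.C (algebraMap ℂ (SmoothFun n M) c)).coeff k)

end

end FOI

end

/-!
In coordinates `x` at `x₀` substitute `x = h y`, `ν = h²`: the leading phase `ν⁻¹ φ₋₁` becomes a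
nondegenerate quadratic form in `y` plus terms divisible by `h`, so expanding the exponential turns
the oscillatory integral into a series of Gaussian moments, which only see the Taylor series of the
integrand at `x₀`. Odd moments vanish, so the result is a series in `ν`; it satisfies both FOI
identities because the moments satisfy Gaussian integration by parts, and its leading term is a
nonzero multiple of `δ_{x₀}`.

For uniqueness, Hadamard's lemma writes `f = f(x₀) + ∑ k, ∂ₖφ₋₁ * hₖ` near `x₀`, and the
association identity replaces each `∂ₖφ₋₁ * hₖ` by a multiple of `ν`. Iterating, every `f` is
equivalent to a constant series, so an associated functional is determined by its value at `1`, and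
two of them differ by a factor in `ℂ⟦ν⟧`; the differential equation in `ν` makes this factor
constant.

If `Λ` serves both `φ` and `φ'`, subtracting the two sets of identities shows that `∂ᵢ(φ - φ')` and
`d(φ - φ')/dν` generate ideals killed by `Λ`. By integration by parts the set of such annihilators
is closed under every `∂ᵢ`, and since `Λ₀` is a nonzero multiple of `δ_{x₀}` all their jets vanish.
-/

noncomputable section

namespace FOI

open PowerSeries (X C coeff)
open scoped PowerSeries

section Algebra

theorem derivation_prod {R A ι : Type*} [CommRing R] [CommRing A] [Algebra R A] [DecidableEq ι]
    (D : Derivation R A A) (s : Finset ι) (f : ι → A) :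
    D (∏ i ∈ s, f i) = ∑ i ∈ s, ∏ j ∈ s, Function.update f i (D (f i)) j := by
  induction s using Finset.induction_on with
  | empty => simp
  | insert a s ha ih =>
    have h : ∀ i ∈ s, ∏ j ∈ insert a s, Function.update f i (D (f i)) j
        = f a * ∏ j ∈ s, Function.update f i (D (f i)) j := fun i hi => by
      rw [Finset.prod_insert ha, Function.update_of_ne (ne_of_mem_of_not_mem hi ha).symm]
    rw [Finset.sum_insert ha, Finset.sum_congr rfl h, ← Finset.mul_sum, ← ih,
      Finset.prod_insert ha, Finset.prod_insert ha, Function.update_self,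
      Finset.prod_update_of_notMem ha, D.leibniz, smul_eq_mul, smul_eq_mul]
    ring

theorem derivation_det {R A ι : Type*} [CommRing R] [CommRing A] [Algebra R A]
    [DecidableEq ι] [Fintype ι] (D : Derivation R A A) (m : Matrix ι ι A) :
    D m.det = ∑ i, (m.updateRow i fun j => D (m i j)).det := by
  simp_rw [← Matrix.det_transpose m, ← Matrix.det_transpose (Matrix.updateRow _ _ _),
    Matrix.det_apply, Units.smul_def, map_sum, map_zsmul, derivation_prod, Finset.smul_sum]
  rw [Finset.sum_comm]
  refine Finset.sum_congr rfl fun i _ => Finset.sum_congr rfl fun σ _ => ?_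
  congr 1
  refine Finset.prod_congr rfl fun j _ => ?_
  rcases eq_or_ne j i with rfl | h
  · simp
  · simp [h]

theorem alternatingMap_eq_det_smul {R V W ι : Type*} [CommRing R] [AddCommGroup V] [Module R V]
    [AddCommGroup W] [Module R W] [DecidableEq ι] [Fintype ι] (b : Module.Basis ι R V)
    (f : V [⋀^ι]→ₗ[R] W) (u : ι → V) :
    f u = (Matrix.of fun i j => b.repr (u i) j).det • f b := by
  have h : f = (LinearMap.toSpanSingleton R W (f b)).compAlternatingMap b.det := by
    refine Module.Basis.ext_alternating b fun v hv => ?_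
    obtain ⟨e, he⟩ : ∃ e : Equiv.Perm ι, (fun i => b (v i)) = b ∘ e :=
      ⟨Equiv.ofBijective v (Finite.injective_iff_bijective.1 hv), rfl⟩
    rw [he, AlternatingMap.map_perm, AlternatingMap.map_perm]
    simp [b.det_self]
  conv_lhs => rw [h]
  rw [LinearMap.compAlternatingMap_apply, LinearMap.toSpanSingleton_apply, Module.Basis.det_apply,
    ← Matrix.det_transpose]
  rfl

theorem alternatingMap_sum_apply {R V W ι κ : Type*} [CommSemiring R] [AddCommMonoid V]
    [Module R V] [AddCommMonoid W] [Module R W] (s : Finset κ) (f : κ → V [⋀^ι]→ₗ[R] W)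
    (u : ι → V) : (∑ p ∈ s, f p) u = ∑ p ∈ s, f p u :=
  map_sum (⟨⟨fun g : V [⋀^ι]→ₗ[R] W => g u, rfl⟩, fun _ _ => rfl⟩ : V [⋀^ι]→ₗ[R] W →+ W) f s

theorem pderiv_pderiv_comm {R σ : Type*} [CommRing R] (i j : σ) (p : MvPolynomial σ R) :
    MvPolynomial.pderiv i (MvPolynomial.pderiv j p)
      = MvPolynomial.pderiv j (MvPolynomial.pderiv i p) := by
  classical
  refine sub_eq_zero.1 (DFunLike.congr_fun (MvPolynomial.derivation_ext fun k => ?_ :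
    ⁅MvPolynomial.pderiv (R := R) i, MvPolynomial.pderiv j⁆ = 0) p)
  rw [Derivation.commutator_apply]
  simp [MvPolynomial.pderiv_X, Pi.single_apply, apply_ite (MvPolynomial.pderiv _)]

end Algebra

section SeriesDerivation

variable {R B : Type*} [CommRing R] [CommRing B] [Algebra R B]

/-- A derivation of `B`, applied to the coefficients of formal power series. -/
def seriesDer (D : Derivation R B B) : Derivation R B⟦X⟧ B⟦X⟧ :=
  Derivation.mk'
    { toFun := fun F => PowerSeries.mk fun k => D (coeff k F)
      map_add' := fun F G => by ext k; simp
      map_smul' := fun c F => by ext k; simp }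
    fun F G => by
      ext k
      simp only [LinearMap.coe_mk, AddHom.coe_mk, PowerSeries.coeff_mk, smul_eq_mul, map_add,
        PowerSeries.coeff_mul, map_sum, D.leibniz, Finset.sum_add_distrib]
      congr 1
      rw [← Finset.Nat.sum_antidiagonal_swap]
      simp

@[simp] theorem coeff_seriesDer (D : Derivation R B B) (F : B⟦X⟧) (k : ℕ) :
    coeff k (seriesDer D F) = D (coeff k F) :=
  PowerSeries.coeff_mk k fun k => D (coeff k F)

@[simp] theorem seriesDer_X (D : Derivation R B B) : seriesDer D (X : B⟦X⟧) = 0 := by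
  ext k
  simp [PowerSeries.coeff_X, apply_ite D]

theorem seriesDer_X_pow_mul (D : Derivation R B B) (m : ℕ) (F : B⟦X⟧) :
    seriesDer D (X ^ m * F) = X ^ m * seriesDer D F := by
  rw [Derivation.leibniz, Derivation.leibniz_pow, seriesDer_X, smul_zero, smul_zero, smul_zero,
    add_zero, smul_eq_mul]

theorem seriesDer_X_mul (D : Derivation R B B) (F : B⟦X⟧) :
    seriesDer D (X * F) = X * seriesDer D F := by
  simp [Derivation.leibniz]

theorem derivative_seriesDer (D : Derivation R B B) (F : B⟦X⟧) :
    d⁄dX B (seriesDer D F) = seriesDer D (d⁄dX B F) := by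
  ext k
  simp [PowerSeries.coeff_derivative, mul_comm]

/-- The Euler operator `h d/dh` on formal power series in `h`. -/
def eulerSeries (B : Type*) [CommRing B] : Derivation B B⟦X⟧ B⟦X⟧ :=
  (X : B⟦X⟧) • d⁄dX B

theorem eulerSeries_apply (F : B⟦X⟧) : eulerSeries B F = X * d⁄dX B F := rfl

@[simp] theorem coeff_eulerSeries (F : B⟦X⟧) (k : ℕ) :
    coeff k (eulerSeries B F) = k * coeff k F := by
  rw [eulerSeries_apply]
  cases k with
  | zero => simp
  | succ k => simp [PowerSeries.coeff_succ_X_mul, PowerSeries.coeff_derivative, mul_comm]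

end SeriesDerivation

section Taylor

/-- The algebraic structure which formal Taylor expansion at a point needs: an algebra `A` of
functions, the evaluation at the point, and derivations which commute up to an ideal of functions
invisible at the point (in the application, those which vanish near the point). -/
structure FormalFrame (𝕜 ι A : Type*) [Field 𝕜] [CommRing A] [Algebra 𝕜 A] where
  der : ι → Derivation 𝕜 A A
  ev : A →ₐ[𝕜] 𝕜
  null : Ideal A
  der_mem : ∀ i, ∀ f ∈ null, der i f ∈ null
  ev_null : ∀ f ∈ null, ev f = 0
  comm : ∀ i j f, der i (der j f) - der j (der i f) ∈ null

variable {𝕜 ι A : Type*} [Field 𝕜] [Fintype ι] [CommRing A] [Algebra 𝕜 A]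
  (K : FormalFrame 𝕜 ι A)

/-- The homogeneous part of degree `d` of the Taylor expansion, by the recursion
`(d + 1) f_{d+1} = ∑ᵢ xᵢ (∂ᵢ f)_d`. -/
def taylorCoeff : ℕ → A →ₗ[𝕜] MvPolynomial ι 𝕜
  | 0 => (Algebra.linearMap 𝕜 (MvPolynomial ι 𝕜)).comp K.ev.toLinearMap
  | d + 1 => ((d : 𝕜) + 1)⁻¹ • ∑ i, (LinearMap.mulLeft 𝕜 (MvPolynomial.X i)).comp
      ((taylorCoeff d).comp (K.der i : A →ₗ[𝕜] A))

theorem taylorCoeff_zero (f : A) : taylorCoeff K 0 f = MvPolynomial.C (K.ev f) := rfl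

theorem taylorCoeff_succ (d : ℕ) (f : A) : taylorCoeff K (d + 1) f
    = ((d : 𝕜) + 1)⁻¹ • ∑ i, MvPolynomial.X i * taylorCoeff K d (K.der i f) := by
  simp [taylorCoeff]

theorem taylorCoeff_null (d : ℕ) {f : A} (hf : f ∈ K.null) : taylorCoeff K d f = 0 := by
  induction d generalizing f with
  | zero => rw [taylorCoeff_zero, K.ev_null f hf, map_zero]
  | succ d ih => simp [taylorCoeff_succ, ih (K.der_mem _ f hf)]

/-- The Taylor expansion of `f` at the point along the line `x = h y`, as a power series in `h`
with polynomial coefficients in `y`. -/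
def taylor : A →ₗ[𝕜] (MvPolynomial ι 𝕜)⟦X⟧ where
  toFun f := PowerSeries.mk fun d => taylorCoeff K d f
  map_add' f g := by ext1 d; simp
  map_smul' c f := by ext1 d; simp

@[simp] theorem coeff_taylor (f : A) (d : ℕ) : coeff d (taylor K f) = taylorCoeff K d f :=
  PowerSeries.coeff_mk d fun d => taylorCoeff K d f

variable [CharZero 𝕜]

theorem taylorCoeff_succ_mul (d : ℕ) (f : A) : taylorCoeff K (d + 1) f * (d + 1)
    = ∑ i, MvPolynomial.X i * taylorCoeff K d (K.der i f) := by
  have h : MvPolynomial.C ((d : 𝕜) + 1)⁻¹ * ((d : MvPolynomial ι 𝕜) + 1) = 1 := by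
    rw [show (d : MvPolynomial ι 𝕜) + 1 = MvPolynomial.C ((d : 𝕜) + 1) by simp,
      ← map_mul, inv_mul_cancel₀ (Nat.cast_add_one_ne_zero d), map_one]
  rw [taylorCoeff_succ, MvPolynomial.smul_eq_C_mul, mul_right_comm, h, one_mul]

theorem pderiv_taylorCoeff_succ (d : ℕ) (i : ι) (f : A) :
    MvPolynomial.pderiv i (taylorCoeff K (d + 1) f) = taylorCoeff K d (K.der i f) := by
  classical
  have pderiv_sum : ∀ (d : ℕ) (f : A), MvPolynomial.pderiv i (taylorCoeff K (d + 1) f) * (d + 1)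
      = taylorCoeff K d (K.der i f)
        + ∑ j, MvPolynomial.X j * MvPolynomial.pderiv i (taylorCoeff K d (K.der j f)) := by
    intro d f
    have h := congrArg (MvPolynomial.pderiv i) (taylorCoeff_succ_mul K d f)
    rw [Derivation.leibniz, map_sum] at h
    simpa [MvPolynomial.pderiv_X, Pi.single_apply, Finset.sum_add_distrib, mul_comm, add_comm]
      using h
  have comm : ∀ d j, taylorCoeff K d (K.der i (K.der j f))
      = taylorCoeff K d (K.der j (K.der i f)) := fun d j => by
    rw [← sub_eq_zero, ← map_sub, taylorCoeff_null K d (K.comm i j f)]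
  refine mul_right_cancel₀ (b := (d : MvPolynomial ι 𝕜) + 1) (Nat.cast_add_one_ne_zero d) ?_
  cases d with
  | zero =>
    rw [pderiv_sum]
    simp [taylorCoeff_zero]
  | succ d =>
    have ih := fun f => pderiv_taylorCoeff_succ d i f
    rw [pderiv_sum]
    simp only [ih, comm, ← taylorCoeff_succ_mul]
    push_cast
    ring

theorem seriesDer_taylor (i : ι) (f : A) :
    seriesDer (MvPolynomial.pderiv i) (taylor K f) = X * taylor K (K.der i f) := by
  ext1 d
  cases d with
  | zero => simp [taylorCoeff_zero]
  | succ d => simp [pderiv_taylorCoeff_succ, PowerSeries.coeff_succ_X_mul]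

theorem derivative_taylor (f : A) :
    d⁄dX _ (taylor K f) = ∑ i, C (MvPolynomial.X i) * taylor K (K.der i f) := by
  ext1 d
  simp [PowerSeries.coeff_derivative, taylorCoeff_succ_mul]

theorem taylor_mul (f g : A) : taylor K (f * g) = taylor K f * taylor K g := by
  ext1 d
  induction d generalizing f g with
  | zero => simp [PowerSeries.coeff_mul, taylorCoeff_zero]
  | succ d ih =>
    have leibniz : d⁄dX _ (taylor K f * taylor K g) = ∑ i, C (MvPolynomial.X i)
        * (taylor K f * taylor K (K.der i g) + taylor K g * taylor K (K.der i f)) := by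
      rw [Derivation.leibniz, derivative_taylor, derivative_taylor, smul_eq_mul, smul_eq_mul,
        Finset.mul_sum, Finset.mul_sum, ← Finset.sum_add_distrib]
      exact Finset.sum_congr rfl fun i _ => by ring
    refine mul_right_cancel₀ (b := (d : MvPolynomial ι 𝕜) + 1) (Nat.cast_add_one_ne_zero d) ?_
    rw [← PowerSeries.coeff_derivative, ← PowerSeries.coeff_derivative, leibniz,
      derivative_taylor, map_sum, map_sum]
    refine Finset.sum_congr rfl fun i _ => ?_
    rw [PowerSeries.coeff_C_mul, PowerSeries.coeff_C_mul, Derivation.leibniz, map_add,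
      smul_eq_mul, smul_eq_mul, map_add, map_add, ih, ih]

omit [CharZero 𝕜] in
theorem taylor_algebraMap (c : 𝕜) :
    taylor K (algebraMap 𝕜 A c) = C (MvPolynomial.C c) := by
  ext1 d
  cases d with
  | zero => simp [taylorCoeff_zero]
  | succ d => simp [taylorCoeff_succ]

/-- The Euler vector field `∑ᵢ yᵢ ∂ᵢ`, applied to the coefficients of formal power series. -/
def eulerField (F : (MvPolynomial ι 𝕜)⟦X⟧) : (MvPolynomial ι 𝕜)⟦X⟧ :=
  ∑ i, C (MvPolynomial.X i) * seriesDer (MvPolynomial.pderiv i) F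

omit [CharZero 𝕜] in
theorem eulerField_add (F G : (MvPolynomial ι 𝕜)⟦X⟧) :
    eulerField (F + G) = eulerField F + eulerField G := by
  simp [eulerField, mul_add, Finset.sum_add_distrib]

omit [CharZero 𝕜] in
theorem eulerField_X_pow_mul (m : ℕ) (F : (MvPolynomial ι 𝕜)⟦X⟧) :
    eulerField (X ^ m * F) = X ^ m * eulerField F := by
  simp only [eulerField, seriesDer_X_pow_mul, Finset.mul_sum, mul_left_comm]

theorem eulerSeries_taylor (f : A) : eulerSeries _ (taylor K f) = eulerField (taylor K f) := by
  simp only [eulerSeries_apply, derivative_taylor, eulerField, Finset.mul_sum, seriesDer_taylor,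
    mul_left_comm]

end Taylor

section Rescaling

variable {𝕜 ι A : Type*} [Field 𝕜] [Fintype ι] [CommRing A] [Algebra 𝕜 A]
  (K : FormalFrame 𝕜 ι A)

/-- A formal power series without its constant term, divided by the variable. -/
def shift {B : Type*} [Semiring B] (F : B⟦X⟧) : B⟦X⟧ :=
  PowerSeries.mk fun k => coeff (k + 1) F

@[simp] theorem coeff_shift {B : Type*} [Semiring B] (F : B⟦X⟧) (k : ℕ) :
    coeff k (shift F) = coeff (k + 1) F := PowerSeries.coeff_mk _ _

theorem eq_C_add_X_mul_shift {B : Type*} [Semiring B] (F : B⟦X⟧) :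
    F = C (coeff 0 F) + X * shift F := by
  rw [add_comm, PowerSeries.coeff_zero_eq_constantCoeff]
  exact F.eq_X_mul_shift_add_const

/-- The expansion of a formal function under the substitution `x = h y`, `ν = h²`: the coefficient
of `h ^ d` collects the Taylor coefficients of degree `d - 2b` of the coefficient of `ν ^ b`. -/
def rescale : A⟦X⟧ →ₗ[𝕜] (MvPolynomial ι 𝕜)⟦X⟧ where
  toFun F := PowerSeries.mk fun d => ∑ b ∈ Finset.range (d / 2 + 1),
    taylorCoeff K (d - 2 * b) (coeff b F)
  map_add' F G := by ext1 d; simp [Finset.sum_add_distrib]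
  map_smul' c F := by ext1 d; simp [Finset.smul_sum]

theorem coeff_rescale (F : A⟦X⟧) (d : ℕ) : coeff d (rescale K F)
    = ∑ b ∈ Finset.range (d / 2 + 1), taylorCoeff K (d - 2 * b) (coeff b F) :=
  PowerSeries.coeff_mk d fun d => ∑ b ∈ Finset.range (d / 2 + 1),
    taylorCoeff K (d - 2 * b) (coeff b F)

theorem rescale_C_add_X_mul (f : A) (F : A⟦X⟧) :
    rescale K (C f + X * F) = taylor K f + X ^ 2 * rescale K F := by
  ext1 d
  rw [coeff_rescale, map_add, coeff_taylor, PowerSeries.coeff_X_pow_mul', Finset.sum_range_succ',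
    add_comm]
  congr 1
  · simp
  · split_ifs with h
    · obtain ⟨e, rfl⟩ := Nat.exists_eq_add_of_le' h
      rw [coeff_rescale, Nat.add_sub_cancel, Nat.add_div_right _ (by norm_num)]
      refine Finset.sum_congr rfl fun b _ => ?_
      rw [show e + 2 - 2 * (b + 1) = e - 2 * b by omega]
      simp [PowerSeries.coeff_succ_X_mul]
    · rw [Nat.div_eq_of_lt (by omega), Finset.sum_range_zero]

theorem rescale_eq (F : A⟦X⟧) :
    rescale K F = taylor K (coeff 0 F) + X ^ 2 * rescale K (shift F) := by
  conv_lhs => rw [eq_C_add_X_mul_shift F, rescale_C_add_X_mul]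

theorem rescale_X_mul (F : A⟦X⟧) : rescale K (X * F) = X ^ 2 * rescale K F := by
  simpa using rescale_C_add_X_mul K 0 F

theorem rescale_congr {F G : A⟦X⟧} (h : ∀ k, coeff k F - coeff k G ∈ K.null) :
    rescale K F = rescale K G := by
  rw [← sub_eq_zero, ← map_sub]
  ext1 d
  rw [coeff_rescale, map_zero]
  exact Finset.sum_eq_zero fun b _ => taylorCoeff_null K _ (by simpa using h b)

theorem eq_of_sub_eq_X_pow_mul {B S : Type*} [CommRing B] {L R : S → B⟦X⟧} {m : ℕ} (hm : m ≠ 0)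
    (σ : S → S) (h : ∀ F, L F - R F = X ^ m * (L (σ F) - R (σ F))) (F : S) : L F = R F := by
  rw [← sub_eq_zero]
  ext1 d
  induction d using Nat.strong_induction_on generalizing F with
  | _ d ih =>
    rw [h, PowerSeries.coeff_X_pow_mul']
    split_ifs with hd
    · rw [ih (d - m) (by omega), map_zero, map_zero]
    · rw [map_zero]

variable [CharZero 𝕜]

theorem rescale_C_mul (f : A) (F : A⟦X⟧) :
    rescale K (C f * F) = taylor K f * rescale K F := by
  refine eq_of_sub_eq_X_pow_mul (L := fun F => rescale K (C f * F))
    (R := fun F => taylor K f * rescale K F) two_ne_zero shift (fun F => ?_) F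
  have h : C f * F = C (f * coeff 0 F) + X * (C f * shift F) := by
    conv_lhs => rw [eq_C_add_X_mul_shift F]
    rw [map_mul]
    ring
  rw [h, rescale_C_add_X_mul, taylor_mul, rescale_eq K F]
  ring

theorem rescale_mul (F G : A⟦X⟧) : rescale K (F * G) = rescale K F * rescale K G := by
  refine eq_of_sub_eq_X_pow_mul (L := fun F => rescale K (F * G))
    (R := fun F => rescale K F * rescale K G) two_ne_zero shift (fun F => ?_) F
  have h : F * G = C (coeff 0 F) * G + X * (shift F * G) := by
    conv_lhs => rw [eq_C_add_X_mul_shift F]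
    ring
  rw [h, map_add, rescale_C_mul, rescale_X_mul, rescale_eq K F]
  ring

theorem seriesDer_rescale (i : ι) (F : A⟦X⟧) :
    seriesDer (MvPolynomial.pderiv i) (rescale K F)
      = X * rescale K (seriesDer (K.der i) F) := by
  refine eq_of_sub_eq_X_pow_mul (L := fun F => seriesDer (MvPolynomial.pderiv i) (rescale K F))
    (R := fun F => X * rescale K (seriesDer (K.der i) F)) two_ne_zero shift (fun F => ?_) F
  have h : shift (seriesDer (K.der i) F) = seriesDer (K.der i) (shift F) := by
    ext1 k
    simp
  rw [rescale_eq K F, rescale_eq K (seriesDer (K.der i) F), map_add, seriesDer_taylor,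
    seriesDer_X_pow_mul, coeff_seriesDer, h]
  ring

theorem eulerSeries_rescale (F : A⟦X⟧) :
    eulerSeries _ (rescale K F)
      = eulerField (rescale K F) + 2 * rescale K (eulerSeries A F) := by
  refine eq_of_sub_eq_X_pow_mul (L := fun F => eulerSeries _ (rescale K F))
    (R := fun F => eulerField (rescale K F) + 2 * rescale K (eulerSeries A F)) two_ne_zero
    shift (fun F => ?_) F
  have euler_shift : eulerSeries A F = X * (shift F + eulerSeries A (shift F)) := by
    conv_lhs => rw [eq_C_add_X_mul_shift F]
    simp only [eulerSeries_apply, map_add, PowerSeries.derivative_C, Derivation.leibniz,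
      PowerSeries.derivative_X, smul_eq_mul, mul_one]
    ring
  have euler_X_sq_mul : eulerSeries (MvPolynomial ι 𝕜) (X ^ 2 * rescale K (shift F))
      = X ^ 2 * eulerSeries _ (rescale K (shift F)) + 2 * X ^ 2 * rescale K (shift F) := by
    simp only [eulerSeries_apply, Derivation.leibniz, PowerSeries.derivative_pow,
      PowerSeries.derivative_X, smul_eq_mul]
    push_cast
    ring
  rw [euler_shift, rescale_X_mul, map_add, rescale_eq K F, map_add, euler_X_sq_mul,
    eulerField_add, eulerField_X_pow_mul, eulerSeries_taylor]
  ring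

end Rescaling

section Gaussian

variable {𝕜 ι : Type*} [Field 𝕜] [Fintype ι] (c : Matrix ι ι 𝕜)

/-- The constant vector field `∑ⱼ cᵢⱼ ∂ⱼ` on polynomials. -/
def contract (i : ι) : Derivation 𝕜 (MvPolynomial ι 𝕜) (MvPolynomial ι 𝕜) :=
  ∑ j, c i j • MvPolynomial.pderiv j

theorem contract_apply (i : ι) (p : MvPolynomial ι 𝕜) :
    contract c i p = ∑ j, c i j • MvPolynomial.pderiv j p := by
  have coe_sum := map_sum Derivation.coeFnAddMonoidHom
    (fun j => c i j • MvPolynomial.pderiv (R := 𝕜) j) Finset.univ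
  exact (congrFun coe_sum p).trans (by simp)

/-- The operator `½ ∑ᵢⱼ cᵢⱼ ∂ᵢ ∂ⱼ` on polynomials. -/
def gaussLaplacian : Module.End 𝕜 (MvPolynomial ι 𝕜) :=
  (2⁻¹ : 𝕜) • ∑ i, (contract c i).toLinearMap * (MvPolynomial.pderiv i).toLinearMap

theorem gaussLaplacian_apply (p : MvPolynomial ι 𝕜) :
    gaussLaplacian c p = (2⁻¹ : 𝕜) • ∑ i, contract c i (MvPolynomial.pderiv i p) := by
  simp [gaussLaplacian]

theorem contract_pderiv (i j : ι) (p : MvPolynomial ι 𝕜) :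
    contract c i (MvPolynomial.pderiv j p) = MvPolynomial.pderiv j (contract c i p) := by
  simp only [contract_apply, map_sum, Derivation.map_smul, pderiv_pderiv_comm j]

theorem contract_contract (i j : ι) (p : MvPolynomial ι 𝕜) :
    contract c i (contract c j p) = contract c j (contract c i p) := by
  simp only [contract_apply c j, map_sum, Derivation.map_smul, contract_pderiv]

theorem commute_gaussLaplacian_contract (i : ι) :
    Commute (gaussLaplacian c) (contract c i).toLinearMap :=
  LinearMap.ext fun p => by
    simp [gaussLaplacian_apply, contract_contract c _ i, contract_pderiv]

variable {c} [CharZero 𝕜]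

theorem gaussLaplacian_X_mul (hc : c.IsSymm) (i : ι) (p : MvPolynomial ι 𝕜) :
    gaussLaplacian c (MvPolynomial.X i * p)
      = MvPolynomial.X i * gaussLaplacian c p + contract c i p := by
  classical
  have contract_X : ∀ a, contract c a (MvPolynomial.X i) = MvPolynomial.C (c a i) := fun a => by
    simp [contract_apply, MvPolynomial.pderiv_X, Pi.single_apply, MvPolynomial.smul_eq_C_mul]
  have contract_pderiv_X : ∀ a, contract c a (MvPolynomial.pderiv a (MvPolynomial.X i)) = 0 :=
    fun a => by rw [contract_pderiv, contract_X, MvPolynomial.pderiv_C]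
  have sum_contract : ∑ a, contract c a (MvPolynomial.pderiv a (MvPolynomial.X i * p))
      = MvPolynomial.X i * ∑ a, contract c a (MvPolynomial.pderiv a p)
        + (contract c i p + contract c i p) := by
    have sum_pderiv : ∑ a, MvPolynomial.pderiv a p * MvPolynomial.C (c a i) = contract c i p := by
      simp only [contract_apply, MvPolynomial.smul_eq_C_mul, hc.apply, mul_comm]
    have sum_pderiv_X :
        ∑ a, MvPolynomial.pderiv a (MvPolynomial.X i) * contract c a p = contract c i p := by
      simp [MvPolynomial.pderiv_X, Pi.single_apply]
    simp only [Derivation.leibniz, map_add, smul_eq_mul, contract_X, contract_pderiv_X, mul_zero,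
      zero_add, Finset.sum_add_distrib, ← Finset.mul_sum, sum_pderiv, sum_pderiv_X, add_assoc]
  rw [gaussLaplacian_apply, gaussLaplacian_apply, sum_contract, smul_add, ← two_smul 𝕜, smul_smul,
    inv_mul_cancel₀ two_ne_zero, one_smul, mul_smul_comm]

theorem gaussLaplacian_pow_X_mul (hc : c.IsSymm) (k : ℕ) (i : ι) (p : MvPolynomial ι 𝕜) :
    (gaussLaplacian c ^ (k + 1)) (MvPolynomial.X i * p)
      = MvPolynomial.X i * (gaussLaplacian c ^ (k + 1)) p
        + ((k : 𝕜) + 1) • (gaussLaplacian c ^ k) (contract c i p) := by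
  induction k with
  | zero => simp [gaussLaplacian_X_mul hc]
  | succ k ih =>
    have hcomm := LinearMap.congr_fun
      ((commute_gaussLaplacian_contract c i).pow_left (k + 1)) p
    rw [Module.End.mul_apply, Module.End.mul_apply] at hcomm
    rw [pow_succ' _ (k + 1), Module.End.mul_apply, ih, map_add, map_smul, gaussLaplacian_X_mul hc,
      Module.End.mul_apply, ← Module.End.mul_apply _ (gaussLaplacian c ^ k), ← pow_succ',
      ← Derivation.coeFn_coe, ← hcomm]
    push_cast
    module

theorem exists_gaussLaplacian_pow_eq_zero (hc : c.IsSymm) (p : MvPolynomial ι 𝕜) :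
    ∃ N, ∀ k ≥ N, (gaussLaplacian c ^ k) p = 0 := by
  induction p using MvPolynomial.induction_on with
  | C a =>
    refine ⟨1, fun k hk => ?_⟩
    obtain ⟨l, rfl⟩ := Nat.exists_eq_add_of_le' hk
    rw [pow_succ, Module.End.mul_apply, gaussLaplacian_apply]
    simp
  | add p q hp hq =>
    obtain ⟨N, hN⟩ := hp
    obtain ⟨N', hN'⟩ := hq
    refine ⟨max N N', fun k hk => ?_⟩
    rw [map_add, hN k (le_of_max_le_left hk), hN' k (le_of_max_le_right hk), add_zero]
  | mul_X p i hp =>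
    obtain ⟨N, hN⟩ := hp
    refine ⟨N + 1, fun k hk => ?_⟩
    obtain ⟨l, rfl⟩ := Nat.exists_eq_add_of_le' ((Nat.le_add_left 1 N).trans hk)
    have hcomm := LinearMap.congr_fun ((commute_gaussLaplacian_contract c i).pow_left l) p
    rw [Module.End.mul_apply, Module.End.mul_apply, hN l (by omega), map_zero] at hcomm
    rw [mul_comm, gaussLaplacian_pow_X_mul hc, hN _ (by omega), ← Derivation.coeFn_coe, hcomm,
      mul_zero, smul_zero, add_zero]

theorem finite_support_gauss (hc : c.IsSymm) (p : MvPolynomial ι 𝕜) :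
    (Function.support fun k : ℕ =>
      ((k.factorial : 𝕜)⁻¹ * MvPolynomial.constantCoeff ((gaussLaplacian c ^ k) p))).Finite := by
  obtain ⟨N, hN⟩ := exists_gaussLaplacian_pow_eq_zero hc p
  refine (Set.finite_lt_nat N).subset fun k hk => ?_
  by_contra h
  exact hk (by simp [hN k (not_lt.1 h)])

/-- The expectation of polynomials with respect to the formal Gaussian of covariance `c`: the value
at the origin of `exp (½ ∑ᵢⱼ cᵢⱼ ∂ᵢ ∂ⱼ) p`. -/
def gauss (hc : c.IsSymm) : MvPolynomial ι 𝕜 →ₗ[𝕜] 𝕜 where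
  toFun p := ∑ᶠ k : ℕ,
    ((k.factorial : 𝕜)⁻¹ * MvPolynomial.constantCoeff ((gaussLaplacian c ^ k) p))
  map_add' p q := by
    rw [← finsum_add_distrib (finite_support_gauss hc p) (finite_support_gauss hc q)]
    simp [mul_add]
  map_smul' a p := by
    rw [RingHom.id_apply, smul_eq_mul, mul_finsum' _ _ (finite_support_gauss hc p)]
    simp only [map_smul, MvPolynomial.constantCoeff_smul, smul_eq_mul, mul_left_comm]

theorem gauss_eq_sum (hc : c.IsSymm) (p : MvPolynomial ι 𝕜) :
    ∃ N, ∀ m ≥ N, gauss hc p = ∑ k ∈ Finset.range m,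
      ((k.factorial : 𝕜)⁻¹ * MvPolynomial.constantCoeff ((gaussLaplacian c ^ k) p)) := by
  obtain ⟨N, hN⟩ := exists_gaussLaplacian_pow_eq_zero hc p
  refine ⟨N, fun m hm => finsum_eq_sum_of_support_subset _ fun k hk => ?_⟩
  by_contra h
  have hmk : m ≤ k := by simpa using h
  exact hk (by simp [hN k (hm.le.trans hmk)])

theorem gauss_C (hc : c.IsSymm) (a : 𝕜) : gauss hc (MvPolynomial.C a) = a := by
  obtain ⟨N, hN⟩ := gauss_eq_sum hc (MvPolynomial.C a)
  rw [hN (N + 1) (by omega), Finset.sum_range_succ', Finset.sum_eq_zero fun k _ => ?_]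
  · simp
  · rw [pow_succ, Module.End.mul_apply, gaussLaplacian_apply]
    simp

theorem gauss_X_mul (hc : c.IsSymm) (i : ι) (p : MvPolynomial ι 𝕜) :
    gauss hc (MvPolynomial.X i * p) = gauss hc (contract c i p) := by
  obtain ⟨N, hN⟩ := gauss_eq_sum hc (MvPolynomial.X i * p)
  obtain ⟨N', hN'⟩ := gauss_eq_sum hc (contract c i p)
  rw [hN (N + N' + 1) (by omega), hN' (N + N') (by omega), Finset.sum_range_succ']
  simp only [pow_zero, Module.End.one_apply, map_mul, MvPolynomial.constantCoeff_X, zero_mul,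
    mul_zero, add_zero]
  refine Finset.sum_congr rfl fun k _ => ?_
  have hk : (k : 𝕜) + 1 ≠ 0 := Nat.cast_add_one_ne_zero k
  rw [gaussLaplacian_pow_X_mul hc, map_add, map_mul, MvPolynomial.constantCoeff_X, zero_mul,
    zero_add, MvPolynomial.constantCoeff_smul, Nat.factorial_succ, smul_eq_mul]
  push_cast
  field_simp

variable [DecidableEq ι]

theorem gauss_neg_inv_integration_by_parts {h : Matrix ι ι 𝕜} (hc : (-h⁻¹).IsSymm)
    (hdet : IsUnit h.det) (i : ι) (p : MvPolynomial ι 𝕜) :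
    gauss hc (MvPolynomial.pderiv i p
      + (∑ j, MvPolynomial.C (h i j) * MvPolynomial.X j) * p) = 0 := by
  have gauss_C_mul_X_mul : ∀ j, gauss hc (MvPolynomial.C (h i j) * MvPolynomial.X j * p)
      = ∑ l, h i j * (-h⁻¹) j l * gauss hc (MvPolynomial.pderiv l p) := fun j => by
    rw [mul_assoc, ← MvPolynomial.smul_eq_C_mul, map_smul, gauss_X_mul, contract_apply, map_sum,
      smul_eq_mul, Finset.mul_sum]
    exact Finset.sum_congr rfl fun l _ => by rw [map_smul, smul_eq_mul, mul_assoc]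
  have mul_neg_inv : ∀ l, ∑ j, h i j * (-h⁻¹) j l = -(1 : Matrix ι ι 𝕜) i l := fun l => by
    rw [← Matrix.mul_apply, Matrix.mul_neg, Matrix.mul_nonsing_inv _ hdet, Matrix.neg_apply]
  rw [Finset.sum_mul, map_add, map_sum, Finset.sum_congr rfl fun j _ => gauss_C_mul_X_mul j,
    Finset.sum_comm]
  simp only [← Finset.sum_mul, mul_neg_inv]
  simp [Matrix.one_apply]

end Gaussian

section Exponential

variable {R B : Type*} [CommRing R] [CommRing B] [Algebra R B] [Algebra ℚ B]

/-- The exponential of the power series `S - S(0)`. The constant term is left out because its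
exponential is not defined in a general ring. -/
def expSeries (S : B⟦X⟧) : B⟦X⟧ :=
  (PowerSeries.exp B).subst (S - C (coeff 0 S))

omit [Algebra ℚ B] in
theorem hasSubst_sub_C_coeff_zero (S : B⟦X⟧) : PowerSeries.HasSubst (S - C (coeff 0 S)) :=
  PowerSeries.HasSubst.of_constantCoeff_zero' (by simp)

theorem coeff_zero_expSeries (S : B⟦X⟧) : coeff 0 (expSeries S) = 1 := by
  have hS := hasSubst_sub_C_coeff_zero S
  have constantCoeff_eq_zero : PowerSeries.constantCoeff (S - C (coeff 0 S)) = 0 := by simp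
  have exp_sub_one := PowerSeries.constantCoeff_subst_eq_zero constantCoeff_eq_zero
    (PowerSeries.exp B - 1) (by simp)
  have subst_exp : expSeries S = (PowerSeries.exp B - 1).subst (S - C (coeff 0 S)) + 1 := by
    rw [← PowerSeries.coe_substAlgHom hS, map_sub, map_one, sub_add_cancel,
      PowerSeries.coe_substAlgHom hS, expSeries]
  rw [subst_exp, map_add, PowerSeries.coeff_zero_one,
    PowerSeries.coeff_zero_eq_constantCoeff_apply]
  exact (congrArg (· + 1) exp_sub_one).trans (zero_add 1)

theorem derivative_expSeries (S : B⟦X⟧) :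
    d⁄dX B (expSeries S) = expSeries S * d⁄dX B S := by
  rw [expSeries, PowerSeries.derivative_subst (hasSubst_sub_C_coeff_zero S),
    PowerSeries.derivative_exp, map_sub, PowerSeries.derivative_C, sub_zero]

omit [Algebra ℚ B] in
theorem eq_zero_of_derivative_eq_mul [IsAddTorsionFree B] {D Z : B⟦X⟧} (h0 : coeff 0 D = 0)
    (h : d⁄dX B D = D * Z) : D = 0 := by
  ext1 d
  induction d using Nat.strong_induction_on with
  | _ d ih =>
    cases d with
    | zero => rw [h0, map_zero]
    | succ d =>
      have coeff_mul_succ : coeff (d + 1) D * (d + 1) = 0 := by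
        rw [← PowerSeries.coeff_derivative, h, PowerSeries.coeff_mul]
        refine Finset.sum_eq_zero fun p hp => ?_
        rw [ih p.1 (Finset.Nat.antidiagonal.fst_lt hp), map_zero, zero_mul]
      rw [mul_comm, ← Nat.cast_succ, ← nsmul_eq_mul] at coeff_mul_succ
      exact (smul_eq_zero_iff_right d.succ_ne_zero).1 coeff_mul_succ

theorem seriesDer_expSeries (D : Derivation R B B) (S : B⟦X⟧) :
    seriesDer D (expSeries S) = expSeries S * (seriesDer D S - C (D (coeff 0 S))) := by
  have : IsAddTorsionFree B := .of_module_rat B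
  rw [← sub_eq_zero]
  refine eq_zero_of_derivative_eq_mul (Z := d⁄dX B S) ?_ ?_
  · rw [map_sub, coeff_seriesDer, PowerSeries.coeff_mul]
    simp [coeff_zero_expSeries]
  · simp only [map_sub, derivative_seriesDer, derivative_expSeries, Derivation.leibniz,
      PowerSeries.derivative_C, smul_eq_mul]
    ring

end Exponential

section WeightedGauss

/-- A linear functional, applied to the coefficients of even degree of a formal power series. -/
def evenFunctional {𝕜 V : Type*} [CommRing 𝕜] [CommRing V] [Algebra 𝕜 V] (G : V →ₗ[𝕜] 𝕜) :
    V⟦X⟧ →ₗ[𝕜] 𝕜⟦X⟧ where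
  toFun F := PowerSeries.mk fun k => G (coeff (2 * k) F)
  map_add' F F' := by ext1 k; simp
  map_smul' a F := by ext1 k; simp

section EvenFunctional

variable {𝕜 V : Type*} [CommRing 𝕜] [CommRing V] [Algebra 𝕜 V] (G : V →ₗ[𝕜] 𝕜) (F : V⟦X⟧)

theorem coeff_evenFunctional (k : ℕ) :
    coeff k (evenFunctional G F) = G (coeff (2 * k) F) :=
  PowerSeries.coeff_mk k fun k => G (coeff (2 * k) F)

theorem evenFunctional_X_sq_mul : evenFunctional G (X ^ 2 * F) = X * evenFunctional G F := by
  ext1 k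
  rw [coeff_evenFunctional, PowerSeries.coeff_X_pow_mul']
  cases k with
  | zero => simp
  | succ k =>
    rw [if_pos (by omega), PowerSeries.coeff_succ_X_mul, coeff_evenFunctional]
    rfl

theorem evenFunctional_eulerSeries :
    evenFunctional G (eulerSeries V F) = 2 * eulerSeries 𝕜 (evenFunctional G F) := by
  ext1 k
  have two_mul_cast : ((2 * k : ℕ) : V) * coeff (2 * k) F
      = ((2 * k : ℕ) : 𝕜) • coeff (2 * k) F := by
    rw [Algebra.smul_def, map_natCast]
  rw [← map_ofNat C 2, PowerSeries.coeff_C_mul, coeff_evenFunctional, coeff_eulerSeries,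
    coeff_eulerSeries, coeff_evenFunctional, two_mul_cast, map_smul, smul_eq_mul]
  push_cast
  ring

end EvenFunctional

variable {𝕜 ι : Type*} [Field 𝕜] [CharZero 𝕜] [Fintype ι] {c : Matrix ι ι 𝕜} (hc : c.IsSymm)
  (S : (MvPolynomial ι 𝕜)⟦X⟧)

/-- The formal Gaussian integral with weight `exp S`, as a power series in `ν = h²`. The quadratic
form `S(0)` is not part of the weight, but is accounted for by the covariance `c`. -/
def weightedGauss : (MvPolynomial ι 𝕜)⟦X⟧ →ₗ[𝕜] 𝕜⟦X⟧ :=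
  evenFunctional (gauss hc) ∘ₗ LinearMap.mulLeft 𝕜 (expSeries S)

theorem weightedGauss_apply (Y : (MvPolynomial ι 𝕜)⟦X⟧) :
    weightedGauss hc S Y = evenFunctional (gauss hc) (expSeries S * Y) := rfl

theorem weightedGauss_X_sq_mul (Y : (MvPolynomial ι 𝕜)⟦X⟧) :
    weightedGauss hc S (X ^ 2 * Y) = X * weightedGauss hc S Y := by
  rw [weightedGauss_apply, mul_left_comm, evenFunctional_X_sq_mul, weightedGauss_apply]

theorem weightedGauss_eulerSeries (Y : (MvPolynomial ι 𝕜)⟦X⟧) :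
    weightedGauss hc S (eulerSeries _ Y + eulerSeries _ S * Y)
      = 2 * eulerSeries 𝕜 (weightedGauss hc S Y) := by
  rw [weightedGauss_apply, weightedGauss_apply, ← evenFunctional_eulerSeries, Derivation.leibniz,
    smul_eq_mul, smul_eq_mul, eulerSeries_apply (expSeries S), derivative_expSeries,
    eulerSeries_apply S]
  congr 1
  ring

theorem coeff_zero_weightedGauss {Y : (MvPolynomial ι 𝕜)⟦X⟧} {a : 𝕜}
    (hY : coeff 0 Y = MvPolynomial.C a) : coeff 0 (weightedGauss hc S Y) = a := by
  rw [weightedGauss_apply, coeff_evenFunctional, mul_zero, PowerSeries.coeff_mul,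
    Finset.Nat.antidiagonal_zero, Finset.sum_singleton, coeff_zero_expSeries, one_mul, hY, gauss_C]

theorem coeff_weightedGauss_mul (Y : (MvPolynomial ι 𝕜)⟦X⟧) (k : ℕ) :
    ∃ m : ℕ → MvPolynomial ι 𝕜 →ₗ[𝕜] 𝕜, ∀ T, coeff k (weightedGauss hc S (Y * T))
      = ∑ b ∈ Finset.range (2 * k + 1), m b (coeff b T) := by
  refine ⟨fun b => gauss hc ∘ₗ LinearMap.mulLeft 𝕜 (coeff (2 * k - b) (expSeries S * Y)),
    fun T => ?_⟩
  rw [weightedGauss_apply, coeff_evenFunctional, ← mul_assoc, mul_comm (_ * Y),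
    PowerSeries.coeff_mul, Finset.Nat.sum_antidiagonal_eq_sum_range_succ_mk, map_sum]
  refine Finset.sum_congr rfl fun b _ => ?_
  rw [LinearMap.comp_apply, LinearMap.mulLeft_apply, mul_comm]

variable [DecidableEq ι] {h : Matrix ι ι 𝕜} (hh : (-h⁻¹).IsSymm) {S}

theorem weightedGauss_integration_by_parts (hdet : IsUnit h.det)
    (hS : ∀ i, MvPolynomial.pderiv i (coeff 0 S)
      = ∑ j, MvPolynomial.C (h i j) * MvPolynomial.X j)
    (i : ι) (Y : (MvPolynomial ι 𝕜)⟦X⟧) :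
    weightedGauss hh S (seriesDer (MvPolynomial.pderiv i) Y
      + seriesDer (MvPolynomial.pderiv i) S * Y) = 0 := by
  have weight_mul : expSeries S
        * (seriesDer (MvPolynomial.pderiv i) Y + seriesDer (MvPolynomial.pderiv i) S * Y)
      = seriesDer (MvPolynomial.pderiv i) (expSeries S * Y)
        + C (MvPolynomial.pderiv i (coeff 0 S)) * (expSeries S * Y) := by
    rw [Derivation.leibniz, seriesDer_expSeries, smul_eq_mul, smul_eq_mul]
    ring
  ext1 k
  rw [weightedGauss_apply, coeff_evenFunctional, weight_mul, map_add, coeff_seriesDer,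
    PowerSeries.coeff_C_mul, hS, map_zero]
  exact gauss_neg_inv_integration_by_parts hh hdet i _

theorem weightedGauss_eulerField (hdet : IsUnit h.det)
    (hS : ∀ i, MvPolynomial.pderiv i (coeff 0 S)
      = ∑ j, MvPolynomial.C (h i j) * MvPolynomial.X j) (Y : (MvPolynomial ι 𝕜)⟦X⟧) :
    weightedGauss hh S (eulerField Y + eulerField S * Y)
      = -((Fintype.card ι : 𝕜) • weightedGauss hh S Y) := by
  have seriesDer_C_X : ∀ i : ι, seriesDer (MvPolynomial.pderiv (R := 𝕜) i) (C (MvPolynomial.X i))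
      = 1 := fun i => by
    ext1 k
    rw [coeff_seriesDer, PowerSeries.coeff_C, PowerSeries.coeff_one]
    split_ifs <;> simp
  have sum_divergence : eulerField Y + eulerField S * Y
      = ∑ i, (seriesDer (MvPolynomial.pderiv i) (C (MvPolynomial.X i) * Y)
        + seriesDer (MvPolynomial.pderiv i) S * (C (MvPolynomial.X i) * Y) - Y) := by
    rw [eulerField, eulerField, Finset.sum_mul, ← Finset.sum_add_distrib]
    refine Finset.sum_congr rfl fun i _ => ?_
    rw [Derivation.leibniz, seriesDer_C_X, smul_eq_mul, smul_eq_mul]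
    ring
  rw [sum_divergence, map_sum]
  simp only [map_sub, weightedGauss_integration_by_parts hh hdet hS, zero_sub, Finset.sum_const,
    Finset.card_univ, smul_neg, Nat.cast_smul_eq_nsmul]

end WeightedGauss

section FormalIntegral

variable {𝕜 ι A : Type*} [Field 𝕜] [CommRing A] [Algebra 𝕜 A]
  (K : FormalFrame 𝕜 ι A)

/-- The matrix of second derivatives of a function at the point. -/
def frameHessian (f : A) : Matrix ι ι 𝕜 :=
  Matrix.of fun i j => K.ev (K.der i (K.der j f))

theorem isSymm_frameHessian (f : A) : (frameHessian K f).IsSymm := by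
  ext i j
  rw [Matrix.transpose_apply, frameHessian, Matrix.of_apply, Matrix.of_apply, ← sub_eq_zero,
    ← map_sub, K.ev_null _ (K.comm j i _)]

variable [Fintype ι]

theorem isSymm_neg_inv_frameHessian [DecidableEq ι] (f : A) :
    (-(frameHessian K f)⁻¹).IsSymm :=
  (isSymm_frameHessian K f).inv.neg

/-- `Φ` is a formal phase: its leading coefficient has at the point a nondegenerate critical point
with critical value zero. The formal phase function of the oscillatory integral is `Φ / ν`. -/
structure IsPhase [DecidableEq ι] (Φ : A⟦X⟧) : Prop where
  ev_eq_zero : K.ev (coeff 0 Φ) = 0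
  ev_der_eq_zero : ∀ i, K.ev (K.der i (coeff 0 Φ)) = 0
  isUnit_det : IsUnit (frameHessian K (coeff 0 Φ)).det

/-- The formal phase function `Φ / ν` under the substitution `x = h y`, `ν = h²`. -/
def reducedPhase (Φ : A⟦X⟧) : (MvPolynomial ι 𝕜)⟦X⟧ :=
  PowerSeries.mk fun d => coeff (d + 2) (rescale K Φ)

/-- The formal integral of `exp (Φ / ν)`, as a functional on series in `h` with polynomial
coefficients in `y = x / h`. -/
def formalIntegral [CharZero 𝕜] [DecidableEq ι] (Φ : A⟦X⟧) :
    (MvPolynomial ι 𝕜)⟦X⟧ →ₗ[𝕜] 𝕜⟦X⟧ :=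
  weightedGauss (isSymm_neg_inv_frameHessian K (coeff 0 Φ)) (reducedPhase K Φ)

variable [CharZero 𝕜] [DecidableEq ι] {K} {Φ : A⟦X⟧}

omit [CharZero 𝕜] in
theorem IsPhase.X_sq_mul_reducedPhase (hΦ : IsPhase K Φ) :
    X ^ 2 * reducedPhase K Φ = rescale K Φ := by
  ext1 d
  rw [PowerSeries.coeff_X_pow_mul']
  rcases Nat.lt_or_ge d 2 with hd | hd
  · rw [if_neg (by omega), coeff_rescale, Nat.div_eq_of_lt hd, Finset.sum_range_one,
      mul_zero, Nat.sub_zero]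
    interval_cases d
    · rw [taylorCoeff_zero, hΦ.ev_eq_zero, map_zero]
    · simp only [taylorCoeff_succ, taylorCoeff_zero, hΦ.ev_der_eq_zero, map_zero, mul_zero,
        Finset.sum_const_zero, smul_zero]
  · rw [if_pos hd, reducedPhase, PowerSeries.coeff_mk, Nat.sub_add_cancel hd]

omit [DecidableEq ι] in
theorem pderiv_coeff_zero_reducedPhase (i : ι) :
    MvPolynomial.pderiv i (coeff 0 (reducedPhase K Φ))
      = ∑ j, MvPolynomial.C (frameHessian K (coeff 0 Φ) i j) * MvPolynomial.X j := by
  have coeff_zero : coeff 0 (reducedPhase K Φ)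
      = taylorCoeff K 2 (coeff 0 Φ) + taylorCoeff K 0 (coeff 1 Φ) := by
    rw [reducedPhase, PowerSeries.coeff_mk, coeff_rescale]
    simp [Finset.sum_range_succ]
  rw [coeff_zero, map_add, pderiv_taylorCoeff_succ, taylorCoeff_zero, MvPolynomial.pderiv_C,
    add_zero, taylorCoeff_succ]
  simp only [Nat.cast_zero, zero_add, inv_one, one_smul, taylorCoeff_zero]
  exact Finset.sum_congr rfl fun j _ => by rw [mul_comm, ← (isSymm_frameHessian K _).apply]; rfl

theorem IsPhase.X_mul_seriesDer_reducedPhase (hΦ : IsPhase K Φ) (i : ι) :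
    X * seriesDer (MvPolynomial.pderiv i) (reducedPhase K Φ)
      = rescale K (seriesDer (K.der i) Φ) := by
  refine mul_left_cancel₀ PowerSeries.X_ne_zero ?_
  rw [← seriesDer_rescale, ← hΦ.X_sq_mul_reducedPhase, seriesDer_X_pow_mul]
  ring

theorem IsPhase.X_sq_mul_eulerSeries_reducedPhase (hΦ : IsPhase K Φ) :
    X ^ 2 * eulerSeries _ (reducedPhase K Φ)
      = X ^ 2 * eulerField (reducedPhase K Φ) + 2 * rescale K (eulerSeries A Φ - Φ) := by
  have euler := eulerSeries_rescale K Φ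
  rw [← hΦ.X_sq_mul_reducedPhase, eulerField_X_pow_mul, Derivation.leibniz, smul_eq_mul,
    smul_eq_mul, eulerSeries_apply (X ^ 2), PowerSeries.derivative_pow,
    PowerSeries.derivative_X] at euler
  rw [map_sub, ← hΦ.X_sq_mul_reducedPhase]
  push_cast at euler
  linear_combination euler

theorem formalIntegral_X_sq_mul (Y : (MvPolynomial ι 𝕜)⟦X⟧) :
    formalIntegral K Φ (X ^ 2 * Y) = X * formalIntegral K Φ Y :=
  weightedGauss_X_sq_mul _ _ Y

theorem coeff_zero_formalIntegral_rescale (Z : A⟦X⟧) :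
    coeff 0 (formalIntegral K Φ (rescale K Z)) = K.ev (coeff 0 Z) :=
  coeff_zero_weightedGauss _ _ (by simp [coeff_rescale, taylorCoeff_zero])

theorem IsPhase.formalIntegral_integration_by_parts (hΦ : IsPhase K Φ) (i : ι)
    (Y : (MvPolynomial ι 𝕜)⟦X⟧) :
    formalIntegral K Φ (X * seriesDer (MvPolynomial.pderiv i) Y
      + rescale K (seriesDer (K.der i) Φ) * Y) = 0 := by
  have ibp := weightedGauss_integration_by_parts (isSymm_neg_inv_frameHessian K (coeff 0 Φ))
    hΦ.isUnit_det (pderiv_coeff_zero_reducedPhase (K := K)) i (X * Y)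
  rwa [seriesDer_X_mul, mul_left_comm, ← mul_assoc, hΦ.X_mul_seriesDer_reducedPhase] at ibp

theorem IsPhase.X_mul_eulerSeries_formalIntegral (hΦ : IsPhase K Φ) (Z : A⟦X⟧) :
    X * eulerSeries 𝕜 (formalIntegral K Φ (rescale K Z))
      = formalIntegral K Φ (rescale K (X * eulerSeries A Z + (eulerSeries A Φ - Φ) * Z
        - (Fintype.card ι / 2 : 𝕜) • (X * Z))) := by
  let S := reducedPhase K Φ
  let Y := rescale K Z
  have scaling : X ^ 2 * (eulerSeries _ Y + eulerSeries _ S * Y)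
      = X ^ 2 * (eulerField Y + eulerField S * Y)
        + (2 : 𝕜) • rescale K (X * eulerSeries A Z + (eulerSeries A Φ - Φ) * Z) := by
    rw [eulerSeries_rescale, map_add, rescale_X_mul, rescale_mul, two_smul]
    linear_combination Y * hΦ.X_sq_mul_eulerSeries_reducedPhase
  have integral_scaling := congrArg (formalIntegral K Φ) scaling
  rw [map_add, map_smul, formalIntegral_X_sq_mul, formalIntegral_X_sq_mul, formalIntegral,
    weightedGauss_eulerSeries, weightedGauss_eulerField _ hΦ.isUnit_det
      pderiv_coeff_zero_reducedPhase, ← formalIntegral] at integral_scaling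
  rw [map_sub, map_smul, rescale_X_mul, map_sub, map_smul, formalIntegral_X_sq_mul]
  refine smul_right_injective _ (two_ne_zero (α := 𝕜)) ?_
  simp only [smul_sub, smul_smul, mul_div_cancel₀ _ (two_ne_zero (α := 𝕜))]
  rw [mul_neg, mul_smul_comm] at integral_scaling
  rw [two_smul 𝕜 (X * _)]
  linear_combination integral_scaling

theorem coeff_formalIntegral_mul_taylor (Y : (MvPolynomial ι 𝕜)⟦X⟧) (k : ℕ) :
    ∃ m : ℕ → MvPolynomial ι 𝕜 →ₗ[𝕜] 𝕜, ∀ f, coeff k (formalIntegral K Φ (Y * taylor K f))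
      = ∑ b ∈ Finset.range (2 * k + 1), m b (taylorCoeff K b f) := by
  obtain ⟨m, hm⟩ := coeff_weightedGauss_mul (isSymm_neg_inv_frameHessian K (coeff 0 Φ))
    (reducedPhase K Φ) Y k
  exact ⟨m, fun f => by simpa only [formalIntegral, coeff_taylor] using hm (taylor K f)⟩

end FormalIntegral

section SeriesAction

variable {R A : Type*} [CommRing R] [CommRing A] [Algebra R A] (L : ℕ → A →ₗ[R] R)

/-- The action of a sequence of functionals `Λ₀ + ν Λ₁ + …` on formal power series in `ν`. -/
def seriesAct : A⟦X⟧ →ₗ[R] R⟦X⟧ where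
  toFun F := PowerSeries.mk fun k =>
    ∑ p ∈ Finset.HasAntidiagonal.antidiagonal k, L p.1 (coeff p.2 F)
  map_add' F G := by ext1 k; simp [Finset.sum_add_distrib]
  map_smul' c F := by ext1 k; simp [Finset.mul_sum]

theorem coeff_seriesAct (F : A⟦X⟧) (k : ℕ) : coeff k (seriesAct L F)
    = ∑ p ∈ Finset.HasAntidiagonal.antidiagonal k, L p.1 (coeff p.2 F) :=
  PowerSeries.coeff_mk k fun k =>
    ∑ p ∈ Finset.HasAntidiagonal.antidiagonal k, L p.1 (coeff p.2 F)

theorem coeff_seriesAct_C (f : A) (k : ℕ) : coeff k (seriesAct L (C f)) = L k f := by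
  rw [coeff_seriesAct, Finset.sum_eq_single (k, 0)]
  · simp
  · rintro ⟨a, b⟩ hp hb
    rw [PowerSeries.coeff_C, if_neg, map_zero]
    rintro rfl
    exact hb (by simpa using hp)
  · simp

theorem seriesAct_X_mul (F : A⟦X⟧) : seriesAct L (X * F) = X * seriesAct L F := by
  ext1 k
  rw [coeff_seriesAct]
  cases k with
  | zero => simp
  | succ k =>
    rw [PowerSeries.coeff_succ_X_mul, coeff_seriesAct, Finset.Nat.sum_antidiagonal_succ']
    simp [PowerSeries.coeff_succ_X_mul]

theorem seriesAct_eq (F : A⟦X⟧) :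
    seriesAct L F = seriesAct L (C (coeff 0 F)) + X * seriesAct L (shift F) := by
  conv_lhs => rw [eq_C_add_X_mul_shift F, map_add, seriesAct_X_mul]

end SeriesAction

section FormalOscillatory

variable {𝕜 ι A : Type*} [Field 𝕜] [Fintype ι] [CommRing A] [Algebra 𝕜 A]
  (K : FormalFrame 𝕜 ι A)

/-- The components `Λₖ` of the functional `F ↦ I (rescale (r F))`. -/
def formalComponents (I : (MvPolynomial ι 𝕜)⟦X⟧ →ₗ[𝕜] 𝕜⟦X⟧) (r : A⟦X⟧) (k : ℕ) : A →ₗ[𝕜] 𝕜 :=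
  coeff k ∘ₗ I ∘ₗ LinearMap.mulLeft 𝕜 (rescale K r) ∘ₗ taylor K

variable {K} [CharZero 𝕜]

theorem seriesAct_formalComponents {I : (MvPolynomial ι 𝕜)⟦X⟧ →ₗ[𝕜] 𝕜⟦X⟧}
    (hI : ∀ Y, I (X ^ 2 * Y) = X * I Y) (r F : A⟦X⟧) :
    seriesAct (formalComponents K I r) F = I (rescale K (r * F)) := by
  refine eq_of_sub_eq_X_pow_mul (L := seriesAct (formalComponents K I r))
    (R := fun F => I (rescale K (r * F))) one_ne_zero shift (fun F => ?_) F
  have leading : seriesAct (formalComponents K I r) (C (coeff 0 F))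
      = I (rescale K r * taylor K (coeff 0 F)) :=
    PowerSeries.ext fun k => coeff_seriesAct_C _ _ k
  rw [seriesAct_eq, leading, rescale_mul, rescale_mul, rescale_eq K F, mul_add, mul_left_comm,
    map_add, hI]
  ring

/-- `D` agrees near the point with the vector field `∑ᵢ aᵢ ∂ᵢ`. -/
def IsCombination (K : FormalFrame 𝕜 ι A) (D : Derivation 𝕜 A A) (a : ι → A) : Prop :=
  ∀ f, D f - ∑ i, a i * K.der i f ∈ K.null

/-- `g` agrees near the point with the divergence of the vector field `∑ᵢ aᵢ ∂ᵢ` with respect to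
the density `r`. -/
def IsSeriesDivergence (K : FormalFrame 𝕜 ι A) (r : A⟦X⟧) (a : ι → A) (g : A⟦X⟧) : Prop :=
  ∀ m, coeff m (g * r) - ∑ i, K.der i (a i * coeff m r) ∈ K.null

/-- For `Φ = ν φ`, the formal function `D F + (D φ + g) F` multiplied by `ν`. -/
def assocIntegrand (D : Derivation 𝕜 A A) (Φ g F : A⟦X⟧) : A⟦X⟧ :=
  X * seriesDer D F + (seriesDer D Φ + X * g) * F

variable (𝕜) in
/-- For `Φ = ν φ`, the formal function `dF/dν + (dφ/dν + g - d/(2ν)) F` multiplied by `ν²`. -/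
def strongIntegrand (d : ℕ) (Φ g F : A⟦X⟧) : A⟦X⟧ :=
  X ^ 2 * d⁄dX A F
    + (X * d⁄dX A Φ - Φ + X ^ 2 * g - C (algebraMap 𝕜 A ((d : 𝕜) / 2)) * X) * F

variable {D : Derivation 𝕜 A A} {a : ι → A} {r g : A⟦X⟧}

theorem IsCombination.rescale_seriesDer (hD : IsCombination K D a) (H : A⟦X⟧) :
    rescale K (seriesDer D H)
      = ∑ i, rescale K (C (a i)) * rescale K (seriesDer (K.der i) H) := by
  simp only [← rescale_mul, ← map_sum]
  refine rescale_congr K fun k => ?_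
  simpa only [map_sum, PowerSeries.coeff_C_mul, coeff_seriesDer] using hD (coeff k H)

theorem IsSeriesDivergence.rescale_mul_rescale (hg : IsSeriesDivergence K r a g) :
    rescale K g * rescale K r = ∑ i, rescale K (seriesDer (K.der i) (C (a i) * r)) := by
  rw [← rescale_mul, ← map_sum]
  refine rescale_congr K fun k => ?_
  simpa only [map_sum, PowerSeries.coeff_C_mul, coeff_seriesDer] using hg k

theorem rescale_sum_integrand (hD : IsCombination K D a) (hg : IsSeriesDivergence K r a g)
    (Φ F : A⟦X⟧) :
    rescale K (r * assocIntegrand D Φ g F)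
      = ∑ i, (X * seriesDer (MvPolynomial.pderiv i) (rescale K (C (a i) * r * F))
        + rescale K (seriesDer (K.der i) Φ) * rescale K (C (a i) * r * F)) := by
  have summand : ∀ i, X * seriesDer (MvPolynomial.pderiv i) (rescale K (C (a i) * r * F))
        + rescale K (seriesDer (K.der i) Φ) * rescale K (C (a i) * r * F)
      = X ^ 2 * rescale K r * (rescale K (C (a i)) * rescale K (seriesDer (K.der i) F))
        + rescale K r * rescale K F
          * (rescale K (C (a i)) * rescale K (seriesDer (K.der i) Φ))
        + X ^ 2 * rescale K F * rescale K (seriesDer (K.der i) (C (a i) * r)) := fun i => by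
    rw [seriesDer_rescale, Derivation.leibniz, smul_eq_mul, smul_eq_mul, map_add]
    simp only [rescale_mul]
    ring
  simp only [summand, Finset.sum_add_distrib, ← Finset.mul_sum, ← hD.rescale_seriesDer,
    ← hg.rescale_mul_rescale]
  rw [assocIntegrand, rescale_mul, map_add, rescale_X_mul, add_mul, map_add,
    rescale_mul K (seriesDer D Φ), mul_assoc X, rescale_X_mul, rescale_mul K g]
  ring

variable [DecidableEq ι] {Φ : A⟦X⟧} (hΦ : IsPhase K Φ)
include hΦ

theorem IsPhase.formalIntegral_associated (hD : IsCombination K D a)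
    (hg : IsSeriesDivergence K r a g) (F : A⟦X⟧) :
    formalIntegral K Φ (rescale K (r * assocIntegrand D Φ g F)) = 0 := by
  rw [rescale_sum_integrand hD hg, map_sum]
  exact Finset.sum_eq_zero fun i _ => hΦ.formalIntegral_integration_by_parts i _

theorem IsPhase.X_sq_mul_derivative_formalIntegral
    (hg : ∀ m, coeff m (g * r) - coeff m (d⁄dX A r) ∈ K.null) (F : A⟦X⟧) :
    X ^ 2 * d⁄dX 𝕜 (formalIntegral K Φ (rescale K (r * F)))
      = formalIntegral K Φ (rescale K (r * strongIntegrand 𝕜 (Fintype.card ι) Φ g F)) := by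
  have log_derivative : rescale K (X * (X * (d⁄dX A r * F)))
      = rescale K (X * (X * (g * r * F))) := by
    rw [rescale_X_mul, rescale_X_mul, rescale_X_mul, rescale_X_mul, rescale_mul K (d⁄dX A r),
      rescale_mul K (g * r), rescale_congr K hg]
  have smul_eq : (Fintype.card ι / 2 : 𝕜) • (X * (r * F))
      = C (algebraMap 𝕜 A (Fintype.card ι / 2)) * (X * (r * F)) := by
    ext1 k
    rw [PowerSeries.coeff_smul, PowerSeries.coeff_C_mul, Algebra.smul_def]
  have split_derivative : X * eulerSeries A (r * F) + (eulerSeries A Φ - Φ) * (r * F)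
        - (Fintype.card ι / 2 : 𝕜) • (X * (r * F))
      = X * (X * (d⁄dX A r * F)) + r * (X ^ 2 * d⁄dX A F + (X * d⁄dX A Φ - Φ
        - C (algebraMap 𝕜 A (Fintype.card ι / 2)) * X) * F) := by
    rw [smul_eq, eulerSeries_apply, eulerSeries_apply, Derivation.leibniz, smul_eq_mul, smul_eq_mul]
    ring
  rw [pow_two, mul_assoc, ← eulerSeries_apply, hΦ.X_mul_eulerSeries_formalIntegral,
    split_derivative, map_add, log_derivative, ← map_add, strongIntegrand]
  congr 2
  ring

end FormalOscillatory

section ChartFrame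

variable (n : ℕ) {M : Type*} [TopologicalSpace M] [ChartedSpace (EuclideanSpace ℝ (Fin n)) M]

/-- An arbitrary smooth bump function at `x₀`; it extends objects given on the domain of the
preferred chart to all of `M`. -/
def bump (x₀ : M) : SmoothBumpFunction (𝓡 n) x₀ := Classical.arbitrary _

/-- An open neighbourhood of `x₀` on which `bump n x₀` is `1`; it lies in the domain of the
preferred chart. -/
def frameDomain (x₀ : M) : Set M := interior {x | bump n x₀ x = 1}

theorem isOpen_frameDomain (x₀ : M) : IsOpen (frameDomain n x₀) := isOpen_interior

theorem frameDomain_mem_nhds (x₀ : M) : frameDomain n x₀ ∈ 𝓝 x₀ :=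
  interior_mem_nhds.2 (bump n x₀).eventuallyEq_one

theorem mem_frameDomain (x₀ : M) : x₀ ∈ frameDomain n x₀ :=
  mem_of_mem_nhds (frameDomain_mem_nhds n x₀)

variable {n}

theorem bump_eq_one {x₀ x : M} (hx : x ∈ frameDomain n x₀) : bump n x₀ x = 1 :=
  show x ∈ {x | bump n x₀ x = 1} from interior_subset hx

theorem frameDomain_subset_chartAt_source (x₀ : M) :
    frameDomain n x₀ ⊆ (chartAt (EuclideanSpace ℝ (Fin n)) x₀).source := fun x hx =>
  (bump n x₀).support_subset_source (by simp [Function.mem_support, bump_eq_one hx])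

theorem frameDomain_subset_extChartAt_source (x₀ : M) :
    frameDomain n x₀ ⊆ (extChartAt (𝓡 n) x₀).source := by
  simpa using frameDomain_subset_chartAt_source x₀

variable [IsManifold (𝓡 n) ∞ M]

/-- The trivialization of the tangent bundle given by the preferred chart at `x₀`. -/
abbrev chartTriv (n : ℕ) {M : Type*} [TopologicalSpace M]
    [ChartedSpace (EuclideanSpace ℝ (Fin n)) M] [IsManifold (𝓡 n) ∞ M] (x₀ : M) :=
  trivializationAt (EuclideanSpace ℝ (Fin n)) (TangentSpace (𝓡 n) : M → Type _) x₀

/-- The standard basis of `ℝⁿ`, as a basis in the algebraic sense. -/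
abbrev stdBasis (n : ℕ) : Module.Basis (Fin n) ℝ (EuclideanSpace ℝ (Fin n)) :=
  (EuclideanSpace.basisFun (Fin n) ℝ).toBasis

theorem frameDomain_subset_baseSet (x₀ : M) : frameDomain n x₀ ⊆ (chartTriv n x₀).baseSet := by
  simpa using frameDomain_subset_chartAt_source x₀

/-- The basis of the tangent space at `x` given by the preferred chart at `x₀`. -/
def frameBasis {x₀ x : M} (hx : x ∈ frameDomain n x₀) :
    Module.Basis (Fin n) ℝ (TangentSpace (𝓡 n) x) :=
  (chartTriv n x₀).basisAt (stdBasis n) (frameDomain_subset_baseSet x₀ hx)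

theorem mfderiv_extChartAt_frameBasis {x₀ x : M} (hx : x ∈ frameDomain n x₀) (i : Fin n) :
    mfderiv (𝓡 n) 𝓘(ℝ, EuclideanSpace ℝ (Fin n)) (extChartAt (𝓡 n) x₀) x (frameBasis hx i)
      = EuclideanSpace.single i (1 : ℝ) := by
  have hx' := frameDomain_subset_baseSet x₀ hx
  rw [← TangentBundle.continuousLinearMapAt_trivializationAt
      (frameDomain_subset_chartAt_source x₀ hx), frameBasis, Bundle.Trivialization.basisAt]
  refine Eq.trans ?_ ((chartTriv n x₀).continuousLinearMapAt_symmL (R := ℝ) hx'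
    (EuclideanSpace.single i (1 : ℝ)))
  rw [Module.Basis.map_apply, OrthonormalBasis.coe_toBasis, EuclideanSpace.basisFun_apply,
    Bundle.Trivialization.linearEquivAt_symm_apply]
  exact congrArg _ (Bundle.Trivialization.symmL_apply _ (hb := hx') _).symm

/-- The components of a vector field in the coordinate frame of the preferred chart at `x₀`,
multiplied by a bump function so that they are defined on all of `M`. -/
def coordReal (x₀ : M) (v : SmoothVF n M) (i : Fin n) (x : M) : ℝ :=
  bump n x₀ x * (chartTriv n x₀).localFrameCoeff (𝓡 n) (stdBasis n) i x (v x)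

theorem frameBasis_repr {x₀ x : M} (hx : x ∈ frameDomain n x₀) (v : SmoothVF n M) (i : Fin n) :
    (frameBasis hx).repr (v x) i = coordReal x₀ v i x := by
  rw [coordReal, bump_eq_one hx, one_mul]
  exact ((chartTriv n x₀).localFrameCoeff_apply_of_mem_baseSet (I := 𝓡 n) (stdBasis n)
    (frameDomain_subset_baseSet x₀ hx) (fun x => v x) i).symm

/-- The constant vector field `∂ᵢ` on `ℝⁿ`. -/
def constField (n : ℕ) (i : Fin n) (y : EuclideanSpace ℝ (Fin n)) :
    TangentSpace 𝓘(ℝ, EuclideanSpace ℝ (Fin n)) y := EuclideanSpace.single i (1 : ℝ)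

theorem mlieBracket_constField (i j : Fin n) :
    VectorField.mlieBracket 𝓘(ℝ, EuclideanSpace ℝ (Fin n)) (constField n i) (constField n j)
      = 0 := by
  have flat : VectorField.lieBracket ℝ (fun _ : EuclideanSpace ℝ (Fin n) =>
      (EuclideanSpace.single i (1 : ℝ) : EuclideanSpace ℝ (Fin n)))
      (fun _ => EuclideanSpace.single j (1 : ℝ)) = 0 := by
    ext y : 1
    simp [VectorField.lieBracket]
  rw [← VectorField.mlieBracketWithin_univ]
  exact VectorField.mlieBracketWithin_eq_lieBracketWithin.trans
    (VectorField.lieBracketWithin_univ.trans flat)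

variable [T2Space M]

/-- The coordinate vector fields of the preferred chart at `x₀`, multiplied by a bump function so
that they are defined on all of `M`. -/
def frame (x₀ : M) (i : Fin n) : SmoothVF n M where
  toFun x := bump n x₀ x • (chartTriv n x₀).localFrame (stdBasis n) i x
  contMDiff_toFun :=
    ContMDiffOn.smul_section_of_tsupport (bump n x₀).contMDiff.contMDiffOn
      (chartTriv n x₀).open_baseSet
      (by simpa using (bump n x₀).tsupport_subset_chartAt_source)
      ((chartTriv n x₀).contMDiffOn_localFrame_baseSet (I := 𝓡 n) ∞ (stdBasis n) i)

theorem coe_frameBasis {x₀ x : M} (hx : x ∈ frameDomain n x₀) :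
    (frameBasis hx : Fin n → TangentSpace (𝓡 n) x) = fun i => frame x₀ i x := by
  funext i
  change _ = bump n x₀ x • (chartTriv n x₀).localFrame (stdBasis n) i x
  rw [bump_eq_one hx, one_smul, Bundle.Trivialization.localFrame_apply_of_mem_baseSet
    (hx := frameDomain_subset_baseSet x₀ hx), frameBasis]

theorem frame_eventuallyEq_mpullback {x₀ x : M} (hx : x ∈ frameDomain n x₀) (i : Fin n) :
    (frame x₀ i : ∀ y : M, TangentSpace (𝓡 n) y) =ᶠ[𝓝 x]
      VectorField.mpullback (𝓡 n) 𝓘(ℝ, EuclideanSpace ℝ (Fin n))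
      (extChartAt (𝓡 n) x₀) (constField n i) := by
  filter_upwards [(isOpen_frameDomain n x₀).mem_nhds hx] with y hy
  rw [← congrFun (coe_frameBasis hy) i]
  exact ((isInvertible_mfderiv_extChartAt
    (frameDomain_subset_extChartAt_source x₀ hy)).inverse_apply_eq.2
      (mfderiv_extChartAt_frameBasis hy i).symm).symm

theorem mlieBracket_frame {x₀ x : M} (hx : x ∈ frameDomain n x₀) (i j : Fin n) :
    VectorField.mlieBracket (𝓡 n) (frame x₀ i) (frame x₀ j) x = 0 := by
  have : IsManifold (𝓡 n) (minSmoothness ℝ 3) M := by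
    rw [minSmoothness_of_isRCLikeNormedField]
    infer_instance
  have mdifferentiable_constField : ∀ i, MDifferentiableAt 𝓘(ℝ, EuclideanSpace ℝ (Fin n))
      (𝓘(ℝ, EuclideanSpace ℝ (Fin n)).prod 𝓘(ℝ, EuclideanSpace ℝ (Fin n))) (fun y =>
      (⟨y, constField n i y⟩ : TangentBundle 𝓘(ℝ, EuclideanSpace ℝ (Fin n))
        (EuclideanSpace ℝ (Fin n)))) (extChartAt (𝓡 n) x₀ x) := fun i =>
    (contMDiffAt_vectorSpace_iff_contDiffAt.2 (contDiffAt_const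
      (c := (EuclideanSpace.single i (1 : ℝ) : EuclideanSpace ℝ (Fin n))))).mdifferentiableAt
        (n := 1) one_ne_zero
  rw [(frame_eventuallyEq_mpullback hx i).mlieBracket_vectorField_eq
      (frame_eventuallyEq_mpullback hx j),
    ← VectorField.mpullback_mlieBracket (n := ∞) (mdifferentiable_constField i)
      (mdifferentiable_constField j)
      (contMDiffAt_extChartAt' (frameDomain_subset_chartAt_source x₀ hx))
      (by simpa using ENat.LEInfty.out),
    VectorField.mpullback_apply, mlieBracket_constField]
  exact map_zero _

theorem contMDiff_coordReal (x₀ : M) (v : SmoothVF n M) (i : Fin n) :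
    ContMDiff (𝓡 n) 𝓘(ℝ, ℝ) ∞ (coordReal x₀ v i) :=
  (bump n x₀).contMDiff_smul <|
    (contMDiffOn_baseSet_localFrameCoeff (e := chartTriv n x₀) (I := 𝓡 n)
      (stdBasis n) (k := ∞) (s := fun x => v x) v.contMDiff_toFun.contMDiffOn i).mono
        (by simp)

theorem eq_sum_frame {x₀ x : M} (hx : x ∈ frameDomain n x₀) (v : SmoothVF n M) :
    v x = ∑ i, coordReal x₀ v i x • frame x₀ i x := by
  conv_lhs => rw [← (frameBasis hx).sum_repr (v x)]
  simp only [frameBasis_repr, coe_frameBasis]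

theorem mdifferentiableAt_coordReal (x₀ x : M) (v : SmoothVF n M) (i : Fin n) :
    MDifferentiableAt (𝓡 n) 𝓘(ℝ, ℝ) (coordReal x₀ v i) x :=
  (contMDiff_coordReal x₀ v i).mdifferentiable (by simp) x

end ChartFrame

section Coordinates

theorem mlieBracket_sum_right {𝕜 H E M κ : Type*} [NontriviallyNormedField 𝕜] [TopologicalSpace H]
    [NormedAddCommGroup E] [NormedSpace 𝕜 E] {I : ModelWithCorners 𝕜 E H} [TopologicalSpace M]
    [ChartedSpace H M] [IsManifold I 2 M] [CompleteSpace E] (v : ∀ x : M, TangentSpace I x)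
    {w : κ → ∀ x : M, TangentSpace I x} {x : M} (hw : ∀ j, MDiffAt (T% (w j)) x)
    (s : Finset κ) :
    VectorField.mlieBracket I v (∑ j ∈ s, w j) x
      = ∑ j ∈ s, VectorField.mlieBracket I v (w j) x := by
  classical
  induction s using Finset.induction_on with
  | empty => simp
  | insert j s hj ih =>
    have hs : MDiffAt (T% (∑ j ∈ s, w j)) x := by
      simpa only [Finset.sum_apply] using MDifferentiableAt.sum_section fun j (_ : j ∈ s) => hw j
    rw [Finset.sum_insert hj, VectorField.mlieBracket_add_right (hw j) hs, ih,
      Finset.sum_insert hj]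

variable {n : ℕ} {M : Type*} [TopologicalSpace M] [ChartedSpace (EuclideanSpace ℝ (Fin n)) M]
  [IsManifold (𝓡 n) ∞ M] [T2Space M]

theorem mlieBracket_frame_left {x₀ x : M} (hx : x ∈ frameDomain n x₀) (k : Fin n)
    (w : SmoothVF n M) :
    VectorField.mlieBracket (𝓡 n) (frame x₀ k) w x
      = ∑ j, mvfderiv (𝓡 n) (coordReal x₀ w j) x (frame x₀ k x) • frame x₀ j x := by
  have mdifferentiableAt_frame : ∀ j,
      MDifferentiableAt (𝓡 n) ((𝓡 n).prod 𝓘(ℝ, EuclideanSpace ℝ (Fin n)))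
        (fun y => (⟨y, frame x₀ j y⟩ : TangentBundle (𝓡 n) M)) x := fun j =>
    (frame x₀ j).contMDiff_toFun.mdifferentiable (by simp) x
  have expansion : (w : ∀ y : M, TangentSpace (𝓡 n) y) =ᶠ[𝓝 x]
      (∑ j, coordReal x₀ w j • (frame x₀ j : ∀ y : M, TangentSpace (𝓡 n) y) :
        ∀ y : M, TangentSpace (𝓡 n) y) := by
    filter_upwards [(isOpen_frameDomain n x₀).mem_nhds hx] with y hy
    refine (eq_sum_frame hy w).trans ?_
    rw [Finset.sum_apply]
    rfl
  rw [Filter.EventuallyEq.rfl.mlieBracket_vectorField_eq expansion,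
    mlieBracket_sum_right (frame x₀ k) fun j =>
      (mdifferentiableAt_coordReal x₀ x w j).smul_section (mdifferentiableAt_frame j)]
  refine Finset.sum_congr rfl fun j _ => ?_
  rw [VectorField.mlieBracket_smul_right (mdifferentiableAt_coordReal x₀ x w j)
    (mdifferentiableAt_frame j), mlieBracket_frame hx, smul_zero, add_zero]

end Coordinates

section SmoothFunctions

variable {n : ℕ} {M : Type*} [TopologicalSpace M] [ChartedSpace (EuclideanSpace ℝ (Fin n)) M]

theorem contMDiff_smoothFun (f : SmoothFun n M) : ContMDiff (𝓡 n) 𝓘(ℝ, ℂ) ∞ (f : M → ℂ) := f.2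

theorem mdifferentiableAt_smoothFun (f : SmoothFun n M) (x : M) :
    MDifferentiableAt (𝓡 n) 𝓘(ℝ, ℂ) (f : M → ℂ) x :=
  (contMDiff_smoothFun f).mdifferentiable (by simp) x

/-- Evaluation of smooth functions at a point, as an algebra homomorphism. -/
def evalAt (x : M) : SmoothFun n M →ₐ[ℂ] ℂ :=
  (Pi.evalAlgHom ℂ (fun _ : M => ℂ) x).comp (SmoothFun n M).val

@[simp] theorem smoothFun_mul_apply (f g : SmoothFun n M) (x : M) :
    ((f * g : SmoothFun n M) : M → ℂ) x = (f : M → ℂ) x * (g : M → ℂ) x := rfl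

@[simp] theorem smoothFun_add_apply (f g : SmoothFun n M) (x : M) :
    ((f + g : SmoothFun n M) : M → ℂ) x = (f : M → ℂ) x + (g : M → ℂ) x := rfl

@[simp] theorem smoothFun_sum_apply {ι : Type*} (s : Finset ι) (f : ι → SmoothFun n M) (x : M) :
    ((∑ i ∈ s, f i : SmoothFun n M) : M → ℂ) x = ∑ i ∈ s, (f i : M → ℂ) x :=
  map_sum (evalAt x) f s

theorem smoothFun_det_apply {ι : Type*} [Fintype ι] [DecidableEq ι]
    (m : Matrix ι ι (SmoothFun n M)) (x : M) :
    (m.det : M → ℂ) x = (Matrix.of fun i j => (m i j : M → ℂ) x).det :=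
  RingHom.map_det (evalAt x).toRingHom m

/-- The ideal of the functions which vanish near `x₀`. -/
def germIdeal (n : ℕ) {M : Type*} [TopologicalSpace M]
    [ChartedSpace (EuclideanSpace ℝ (Fin n)) M] (x₀ : M) : Ideal (SmoothFun n M) where
  carrier := {f | (f : M → ℂ) =ᶠ[𝓝 x₀] 0}
  add_mem' hf hg := by simpa using hf.add hg
  zero_mem' := Filter.EventuallyEq.rfl
  smul_mem' c f hf := by simpa using (Filter.EventuallyEq.refl _ (c : M → ℂ)).mul hf

theorem sub_mem_germIdeal {x₀ : M} {f g : SmoothFun n M} :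
    f - g ∈ germIdeal n x₀ ↔ (f : M → ℂ) =ᶠ[𝓝 x₀] g :=
  Filter.eventually_congr (Filter.Eventually.of_forall fun _ => sub_eq_zero)

theorem exists_smoothFun_eq_on_frameDomain [T2Space M] [IsManifold (𝓡 n) ∞ M] {x₀ : M} {g : M → ℂ}
    (hg : ContMDiffOn (𝓡 n) 𝓘(ℝ, ℂ) ∞ g (chartAt (EuclideanSpace ℝ (Fin n)) x₀).source) :
    ∃ f : SmoothFun n M, ∀ x ∈ frameDomain n x₀, (f : M → ℂ) x = g x :=
  ⟨⟨_, (bump n x₀).contMDiff_smul hg⟩, fun x hx => by simp [bump_eq_one hx]⟩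

theorem inChart_extChartAt {x₀ x : M} (hx : x ∈ (extChartAt (𝓡 n) x₀).source) (f : M → ℂ) :
    inChart (n := n) x₀ f (extChartAt (𝓡 n) x₀ x) = f x := by
  rw [inChart, (extChartAt (𝓡 n) x₀).left_inv hx]

theorem contDiffAt_inChart [IsManifold (𝓡 n) ∞ M] (x₀ : M) (f : SmoothFun n M)
    {y : EuclideanSpace ℝ (Fin n)} (hy : y ∈ (extChartAt (𝓡 n) x₀).target) :
    ContDiffAt ℝ ∞ (inChart (n := n) x₀ f) y :=
  ((contMDiff_smoothFun f).contMDiffAt.comp y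
    ((contMDiffOn_extChartAt_symm (I := 𝓡 n) (n := ∞) x₀).contMDiffAt
      (extChartAt_target_mem_nhds' hy))).contDiffAt

variable [T2Space M] [IsManifold (𝓡 n) ∞ M]

theorem exists_eventually_mul_eq_one {x₀ : M} {f : SmoothFun n M} (hf : (f : M → ℂ) x₀ ≠ 0) :
    ∃ g : SmoothFun n M, ∀ᶠ x in 𝓝 x₀, (f : M → ℂ) x * (g : M → ℂ) x = 1 := by
  have ne_zero : {x | (f : M → ℂ) x ≠ 0} ∈ 𝓝 x₀ :=
    (contMDiff_smoothFun f).continuous.continuousAt.eventually_ne hf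
  obtain ⟨χ, -, hχ⟩ := (SmoothBumpFunction.nhds_basis_tsupport (I := 𝓡 n) x₀).mem_iff.1 ne_zero
  refine ⟨⟨fun x => χ x • ((f : M → ℂ) x)⁻¹, contMDiff_of_tsupport fun x hx => ?_⟩, ?_⟩
  · have hx' : (f : M → ℂ) x ≠ 0 := hχ (tsupport_smul_subset_left _ _ hx)
    exact χ.contMDiffAt.smul (((contDiffAt_inv ℂ hx').restrict_scalars ℝ).contMDiffAt.comp x
      (contMDiff_smoothFun f).contMDiffAt)
  · filter_upwards [χ.eventuallyEq_one, ne_zero] with x hχ hf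
    rw [hχ, Pi.one_apply, one_smul, mul_inv_cancel₀ hf]

theorem exists_eventually_coeff_mul_eq {x₀ : M} {F : (SmoothFun n M)⟦X⟧}
    (hF : ((coeff 0 F : SmoothFun n M) : M → ℂ) x₀ ≠ 0) (G : (SmoothFun n M)⟦X⟧) :
    ∃ Q : (SmoothFun n M)⟦X⟧, ∀ᶠ x in 𝓝 x₀, ∀ m,
      ((coeff m (Q * F) : SmoothFun n M) : M → ℂ) x
        = ((coeff m G : SmoothFun n M) : M → ℂ) x := by
  obtain ⟨g, hg⟩ := exists_eventually_mul_eq_one hF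
  let F' : (SmoothFun n M)⟦X⟧ := F * C g + C (1 - coeff 0 F * g)
  have constantCoeff_F' : PowerSeries.constantCoeff F' = ((1 : (SmoothFun n M)ˣ) : SmoothFun n M) :=
    by simp [F']
  refine ⟨G * (C g * F'.invOfUnit 1), ?_⟩
  filter_upwards [hg] with x hx
  have F'_eq : PowerSeries.map (evalAt (n := n) x).toRingHom F'
      = PowerSeries.map (evalAt (n := n) x).toRingHom (F * C g) := by
    have : (evalAt (n := n) x).toRingHom (1 - coeff 0 F * g) = 0 := by
      rw [map_sub, map_one, map_mul, sub_eq_zero]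
      exact hx.symm
    rw [map_add, PowerSeries.map_C, this, map_zero, add_zero]
  have map_eq : PowerSeries.map (evalAt (n := n) x).toRingHom (G * (C g * F'.invOfUnit 1) * F)
      = PowerSeries.map (evalAt (n := n) x).toRingHom G := by
    rw [mul_assoc, map_mul, mul_right_comm, mul_comm (C g), map_mul, ← F'_eq, ← map_mul,
      PowerSeries.mul_invOfUnit _ _ constantCoeff_F', map_one, mul_one]
  intro m
  have coeff_eq := congrArg (coeff m) map_eq
  rw [PowerSeries.coeff_map, PowerSeries.coeff_map] at coeff_eq
  exact coeff_eq

end SmoothFunctions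

section VectorFields

variable {n : ℕ} {M : Type*} [TopologicalSpace M] [ChartedSpace (EuclideanSpace ℝ (Fin n)) M]
  [IsManifold (𝓡 n) ∞ M]

theorem vfApply_apply (v : SmoothVF n M) (f : SmoothFun n M) (x : M) :
    (vfApply v f : M → ℂ) x = mfderiv (𝓡 n) 𝓘(ℝ, ℂ) (f : M → ℂ) x (v x) := rfl

theorem vfApply_mul (v : SmoothVF n M) (f g : SmoothFun n M) :
    vfApply v (f * g) = f * vfApply v g + g * vfApply v f := by
  ext x
  change mfderiv (𝓡 n) 𝓘(ℝ, ℂ) ((f : M → ℂ) * (g : M → ℂ)) x (v x) = _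
  rw [((mdifferentiableAt_smoothFun f x).hasMFDerivAt.mul
    (mdifferentiableAt_smoothFun g x).hasMFDerivAt).mfderiv]
  rfl

theorem vfApply_algebraMap (v : SmoothVF n M) (c : ℂ) :
    vfApply v (algebraMap ℂ (SmoothFun n M) c) = 0 := by
  ext x
  change mfderiv (𝓡 n) 𝓘(ℝ, ℂ) (fun _ : M => c) x (v x) = 0
  rw [mfderiv_const]
  rfl

/-- The derivation of `C^∞(M)` given by a vector field. -/
def vfDer (v : SmoothVF n M) : Derivation ℂ (SmoothFun n M) (SmoothFun n M) :=
  Derivation.mk' { vfApply v with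
    map_smul' := fun c f => by
      simp only [ZeroHom.toFun_eq_coe, AddMonoidHom.toZeroHom_coe, RingHom.id_apply]
      rw [Algebra.smul_def, vfApply_mul, vfApply_algebraMap, mul_zero, add_zero,
        ← Algebra.smul_def] }
    fun f g => by simpa using vfApply_mul v f g

@[simp] theorem vfDer_apply (v : SmoothVF n M) (f : SmoothFun n M) : vfDer v f = vfApply v f := rfl

theorem vfApply_congr {x : M} (v : SmoothVF n M) {f g : SmoothFun n M}
    (h : (f : M → ℂ) =ᶠ[𝓝 x] g) : (vfApply v f : M → ℂ) x = (vfApply v g : M → ℂ) x := by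
  rw [vfApply_apply, vfApply_apply, h.mfderiv_eq]
  rfl

theorem vfApply_mem_germIdeal {x₀ : M} (v : SmoothVF n M) {f : SmoothFun n M}
    (hf : f ∈ germIdeal n x₀) : vfApply v f ∈ germIdeal n x₀ := by
  filter_upwards [Filter.Eventually.eventually_nhds hf] with x hx
  rw [vfApply_congr v (g := 0) hx, map_zero]
  rfl

variable [T2Space M]

theorem vfApply_frame {x₀ x : M} (hx : x ∈ frameDomain n x₀) (i : Fin n) (f : SmoothFun n M) :
    (vfApply (frame x₀ i) f : M → ℂ) x
      = fderiv ℝ (inChart (n := n) x₀ f) (extChartAt (𝓡 n) x₀ x) (EuclideanSpace.single i 1) := by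
  have hs := frameDomain_subset_extChartAt_source x₀ hx
  have through_chart : (f : M → ℂ) =ᶠ[𝓝 x] inChart (n := n) x₀ f ∘ extChartAt (𝓡 n) x₀ := by
    filter_upwards [(isOpen_extChartAt_source x₀).mem_nhds hs] with y hy
    exact (inChart_extChartAt hy f).symm
  have differentiableAt_inChart :
      DifferentiableAt ℝ (inChart (n := n) x₀ f) (extChartAt (𝓡 n) x₀ x) :=
    (contDiffAt_inChart x₀ f ((extChartAt (𝓡 n) x₀).map_source hs)).differentiableAt (by simp)
  have mdifferentiableAt_chart :
      MDifferentiableAt (𝓡 n) 𝓘(ℝ, EuclideanSpace ℝ (Fin n)) (extChartAt (𝓡 n) x₀) x :=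
    mdifferentiableAt_extChartAt (frameDomain_subset_chartAt_source x₀ hx)
  rw [vfApply_apply, through_chart.mfderiv_eq,
    mfderiv_comp x differentiableAt_inChart.mdifferentiableAt mdifferentiableAt_chart,
    ← congrFun (coe_frameBasis hx) i]
  refine (congrArg _ (mfderiv_extChartAt_frameBasis hx i)).trans ?_
  rw [mfderiv_eq_fderiv]
  rfl

theorem inChart_vfApply_frame_eventuallyEq {x₀ x : M} (hx : x ∈ frameDomain n x₀) (i : Fin n)
    (f : SmoothFun n M) :
    inChart (n := n) x₀ (vfApply (frame x₀ i) f) =ᶠ[𝓝 (extChartAt (𝓡 n) x₀ x)]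
      fun y => fderiv ℝ (inChart (n := n) x₀ f) y (EuclideanSpace.single i 1) := by
  have hs := frameDomain_subset_extChartAt_source x₀ hx
  have tendsto_symm :
      Filter.Tendsto (extChartAt (𝓡 n) x₀).symm (𝓝 (extChartAt (𝓡 n) x₀ x)) (𝓝 x) := by
    simpa only [ContinuousAt, (extChartAt (𝓡 n) x₀).left_inv hs] using
      continuousAt_extChartAt_symm' hs
  filter_upwards [tendsto_symm ((isOpen_frameDomain n x₀).mem_nhds hx),
    extChartAt_target_mem_nhds' ((extChartAt (𝓡 n) x₀).map_source hs)] with y hy hyt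
  rw [inChart, vfApply_frame hy, (extChartAt (𝓡 n) x₀).right_inv hyt]

theorem vfApply_frame_frame {x₀ x : M} (hx : x ∈ frameDomain n x₀) (i j : Fin n)
    (f : SmoothFun n M) :
    (vfApply (frame x₀ i) (vfApply (frame x₀ j) f) : M → ℂ) x
      = fderiv ℝ (fderiv ℝ (inChart (n := n) x₀ f)) (extChartAt (𝓡 n) x₀ x)
          (EuclideanSpace.single i 1) (EuclideanSpace.single j 1) := by
  have differentiableAt_fderiv :
      DifferentiableAt ℝ (fderiv ℝ (inChart (n := n) x₀ f)) (extChartAt (𝓡 n) x₀ x) :=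
    ((contDiffAt_inChart x₀ f ((extChartAt (𝓡 n) x₀).map_source
      (frameDomain_subset_extChartAt_source x₀ hx))).fderiv_right (m := 1)
        (show (2 : WithTop ℕ∞) ≤ ∞ from ENat.LEInfty.out)).differentiableAt one_ne_zero
  rw [vfApply_frame hx, (inChart_vfApply_frame_eventuallyEq hx j f).fderiv_eq,
    fderiv_clm_apply differentiableAt_fderiv (differentiableAt_const _)]
  simp

theorem vfApply_frame_comm {x₀ x : M} (hx : x ∈ frameDomain n x₀) (i j : Fin n)
    (f : SmoothFun n M) :
    (vfApply (frame x₀ i) (vfApply (frame x₀ j) f) : M → ℂ) x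
      = (vfApply (frame x₀ j) (vfApply (frame x₀ i) f) : M → ℂ) x := by
  rw [vfApply_frame_frame hx, vfApply_frame_frame hx]
  exact ((contDiffAt_inChart x₀ f ((extChartAt (𝓡 n) x₀).map_source
    (frameDomain_subset_extChartAt_source x₀ hx))).isSymmSndFDerivAt
      (by simpa using ENat.LEInfty.out)).eq _ _

/-- The components of a vector field in the frame `frame x₀`, as complex-valued functions. -/
def coord (x₀ : M) (v : SmoothVF n M) (i : Fin n) : SmoothFun n M :=
  ⟨fun x => (coordReal x₀ v i x : ℂ),
    Complex.ofRealCLM.contDiff.contMDiff.comp (contMDiff_coordReal x₀ v i)⟩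

@[simp] theorem coord_apply (x₀ : M) (v : SmoothVF n M) (i : Fin n) (x : M) :
    (coord x₀ v i : M → ℂ) x = coordReal x₀ v i x := rfl

theorem vfApply_eq_sum {x₀ x : M} (hx : x ∈ frameDomain n x₀) (v : SmoothVF n M)
    (f : SmoothFun n M) :
    (vfApply v f : M → ℂ) x
      = ∑ i, (coord x₀ v i : M → ℂ) x * (vfApply (frame x₀ i) f : M → ℂ) x := by
  simp only [vfApply_apply, coord_apply]
  rw [eq_sum_frame hx v, map_sum]
  refine Finset.sum_congr rfl fun i _ => ?_
  rw [map_smul]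
  exact Complex.real_smul

theorem vfApply_coord (x₀ x : M) (v w : SmoothVF n M) (j : Fin n) :
    (vfApply v (coord x₀ w j) : M → ℂ) x
      = (mvfderiv (𝓡 n) (coordReal x₀ w j) x (v x) : ℝ) := by
  rw [vfApply_apply]
  change mfderiv (𝓡 n) 𝓘(ℝ, ℂ) (Complex.ofRealCLM ∘ coordReal x₀ w j) x (v x) = _
  rw [((Complex.ofRealCLM.hasMFDerivAt (x := coordReal x₀ w j x)).comp x
    (mdifferentiableAt_coordReal x₀ x w j).hasMFDerivAt).mfderiv]
  rfl

end VectorFields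

section Forms

variable {n : ℕ} {M : Type*} [TopologicalSpace M] [ChartedSpace (EuclideanSpace ℝ (Fin n)) M]
  [IsManifold (𝓡 n) ∞ M] {x₀ x : M}

/-- The volume spanned by `u` with respect to the frame `frame x₀`. -/
def frameDet (hx : x ∈ frameDomain n x₀) (u : Fin n → TangentSpace (𝓡 n) x) : ℂ :=
  ((Matrix.of fun i j => (frameBasis hx).repr (u i) j).det : ℝ)

theorem frameDet_eq_det_apply (hx : x ∈ frameDomain n x₀) {u : Fin n → TangentSpace (𝓡 n) x}
    {m : Matrix (Fin n) (Fin n) (SmoothFun n M)}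
    (h : ∀ i j, ((frameBasis hx).repr (u i) j : ℂ) = (m i j : M → ℂ) x) :
    frameDet hx u = (m.det : M → ℂ) x := by
  rw [smoothFun_det_apply, frameDet]
  refine (RingHom.map_det Complex.ofRealHom _).trans ?_
  congr 1
  ext i j
  exact h i j

variable [T2Space M]

/-- The coefficient of a top form with respect to the frame `frame x₀`. -/
def density (x₀ : M) (σ : TopForm n M) : SmoothFun n M :=
  ⟨fun y => σ.form y (fun i => frame x₀ i y), σ.smooth _⟩

/-- The matrix whose rows are the components of the vector fields `w i` in the frame
`frame x₀`. -/
def coordMatrix (x₀ : M) (w : Fin n → SmoothVF n M) : Matrix (Fin n) (Fin n) (SmoothFun n M) :=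
  Matrix.of fun i j => coord x₀ (w i) j

theorem form_apply (hx : x ∈ frameDomain n x₀) (σ : TopForm n M)
    (u : Fin n → TangentSpace (𝓡 n) x) :
    σ.form x u = frameDet hx u * (density x₀ σ : M → ℂ) x := by
  rw [alternatingMap_eq_det_smul (frameBasis hx), Complex.real_smul, coe_frameBasis hx]
  rfl

theorem frameDet_smoothVF (hx : x ∈ frameDomain n x₀) (w : Fin n → SmoothVF n M) :
    frameDet hx (fun i => w i x) = ((coordMatrix x₀ w).det : M → ℂ) x :=
  frameDet_eq_det_apply hx fun i j => by rw [frameBasis_repr]; rfl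

theorem frameDet_update_mlieBracket (hx : x ∈ frameDomain n x₀) (k i : Fin n)
    (w : Fin n → SmoothVF n M) :
    frameDet hx (Function.update (fun j => w j x) i
        (VectorField.mlieBracket (𝓡 n) (frame x₀ k) (w i) x))
      = (((coordMatrix x₀ w).updateRow i fun j => vfDer (frame x₀ k) (coordMatrix x₀ w i j)).det :
          M → ℂ) x := by
  refine frameDet_eq_det_apply hx fun a c => ?_
  rw [Matrix.updateRow_apply, Function.update_apply]
  split_ifs with h
  · simp_rw [mlieBracket_frame_left hx, ← congrFun (coe_frameBasis hx)]
    rw [Module.Basis.repr_sum_self, congrFun (coe_frameBasis hx)]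
    exact (vfApply_coord x₀ x (frame x₀ k) (w i) c).symm
  · rw [frameBasis_repr]
    rfl

theorem form_update_mlieBracket_frame (hx : x ∈ frameDomain n x₀) (v : SmoothVF n M)
    (σ : TopForm n M) (i : Fin n) :
    σ.form x (Function.update (fun j => frame x₀ j x) i
        (VectorField.mlieBracket (𝓡 n) v (frame x₀ i) x))
      = -((vfApply (frame x₀ i) (coord x₀ v i) : M → ℂ) x * (density x₀ σ : M → ℂ) x) := by
  rw [VectorField.mlieBracket_swap_apply, mlieBracket_frame_left hx,
    AlternatingMap.map_update_neg, AlternatingMap.map_update_sum, Finset.sum_eq_single i]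
  · rw [AlternatingMap.map_update_smul, Function.update_eq_self, vfApply_coord, Complex.real_smul]
    rfl
  · intro j _ hj
    rw [AlternatingMap.map_update_smul,
      (σ.form x).map_update_self (fun j => frame x₀ j x) hj.symm, smul_zero]
  · simp

theorem lieDeriv_frame (hx : x ∈ frameDomain n x₀) (v : SmoothVF n M) (σ : TopForm n M) :
    lieDeriv v σ (frame x₀) x
      = ((∑ i, vfApply (frame x₀ i) (coord x₀ v i * density x₀ σ) : SmoothFun n M) :
          M → ℂ) x := by
  rw [lieDeriv, Finset.sum_congr rfl fun i _ => form_update_mlieBracket_frame hx v σ i,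
    Finset.sum_neg_distrib, sub_neg_eq_add]
  change (vfApply v (density x₀ σ) : M → ℂ) x + _ = _
  rw [vfApply_eq_sum hx, ← Finset.sum_add_distrib, smoothFun_sum_apply]
  refine Finset.sum_congr rfl fun i _ => ?_
  rw [vfApply_mul, smoothFun_add_apply, smoothFun_mul_apply, smoothFun_mul_apply]
  ring

theorem frame_lieDeriv (hx : x ∈ frameDomain n x₀) (k : Fin n) (σ : TopForm n M)
    (w : Fin n → SmoothVF n M) :
    lieDeriv (frame x₀ k) σ w x
      = frameDet hx (fun i => w i x) * (vfApply (frame x₀ k) (density x₀ σ) : M → ℂ) x := by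
  have form_eq : (fun y => σ.form y fun i => w i y) =ᶠ[𝓝 x]
      ((coordMatrix x₀ w).det * density x₀ σ : SmoothFun n M) := by
    filter_upwards [(isOpen_frameDomain n x₀).mem_nhds hx] with y hy
    rw [form_apply hy, frameDet_smoothVF hy]
    rfl
  have sum_brackets : ∑ i, σ.form x (Function.update (fun j => w j x) i
        (VectorField.mlieBracket (𝓡 n) (frame x₀ k) (w i) x))
      = (vfApply (frame x₀ k) (coordMatrix x₀ w).det : M → ℂ) x * (density x₀ σ : M → ℂ) x := by
    simp_rw [form_apply hx, frameDet_update_mlieBracket hx]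
    rw [← Finset.sum_mul, ← smoothFun_sum_apply, ← derivation_det, vfDer_apply]
  rw [lieDeriv, sum_brackets,
    vfApply_congr (frame x₀ k) (f := ⟨_, σ.smooth w⟩) form_eq, vfApply_mul,
    smoothFun_add_apply, smoothFun_mul_apply, smoothFun_mul_apply, frameDet_smoothVF hx]
  ring

theorem density_ne_zero {σ : TopForm n M} (h : σ.form x₀ ≠ 0) : (density x₀ σ : M → ℂ) x₀ ≠ 0 := by
  contrapose! h
  refine AlternatingMap.ext fun u => ?_
  rw [form_apply (mem_frameDomain n x₀), h, mul_zero]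
  rfl

variable {ρ : ℕ → TopForm n M} {g : (SmoothFun n M)⟦X⟧}

/-- The coefficient of a formal volume form with respect to the frame `frame x₀`. -/
def densitySeries (x₀ : M) (ρ : ℕ → TopForm n M) : (SmoothFun n M)⟦X⟧ :=
  PowerSeries.mk fun k => density x₀ (ρ k)

@[simp] theorem coeff_densitySeries (x₀ : M) (ρ : ℕ → TopForm n M) (k : ℕ) :
    coeff k (densitySeries x₀ ρ) = density x₀ (ρ k) :=
  PowerSeries.coeff_mk k fun k => density x₀ (ρ k)

theorem sum_antidiagonal_mul_form (hx : x ∈ frameDomain n x₀) (ρ : ℕ → TopForm n M)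
    (g : (SmoothFun n M)⟦X⟧) (u : Fin n → TangentSpace (𝓡 n) x) (m : ℕ) :
    ∑ p ∈ Finset.HasAntidiagonal.antidiagonal m,
        ((coeff p.1 g : SmoothFun n M) : M → ℂ) x * (ρ p.2).form x u
      = frameDet hx u * ((coeff m (g * densitySeries x₀ ρ) : SmoothFun n M) : M → ℂ) x := by
  rw [PowerSeries.coeff_mul, smoothFun_sum_apply, Finset.mul_sum]
  refine Finset.sum_congr rfl fun p _ => ?_
  rw [form_apply hx, smoothFun_mul_apply, coeff_densitySeries]
  ring

theorem frameDet_frame (hx : x ∈ frameDomain n x₀) :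
    frameDet hx (fun i => frame x₀ i x) = 1 := by
  rw [← coe_frameBasis hx, frameDet,
    show (Matrix.of fun i j => (frameBasis hx).repr (frameBasis hx i) j) = 1 by
      ext i j
      simp [Matrix.one_apply, Finsupp.single_apply],
    Matrix.det_one, Complex.ofReal_one]

theorem exists_isDivergence_frame (hρ : (ρ 0).form x₀ ≠ 0) (k : Fin n) :
    ∃ g, IsDivergence x₀ ρ (frame x₀ k) g := by
  obtain ⟨g, hg⟩ := exists_eventually_coeff_mul_eq (F := densitySeries x₀ ρ)
    (by simpa using density_ne_zero hρ) (seriesDer (vfDer (frame x₀ k)) (densitySeries x₀ ρ))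
  refine ⟨g, ?_⟩
  filter_upwards [hg, frameDomain_mem_nhds n x₀] with x hgx hx m w
  rw [sum_antidiagonal_mul_form hx, frame_lieDeriv hx, hgx, coeff_seriesDer, vfDer_apply,
    coeff_densitySeries]

theorem IsDivergence.coeff_mul_densitySeries {v : SmoothVF n M} (h : IsDivergence x₀ ρ v g)
    (m : ℕ) :
    coeff m (g * densitySeries x₀ ρ)
      - ∑ i, vfApply (frame x₀ i) (coord x₀ v i * density x₀ (ρ m)) ∈ germIdeal n x₀ := by
  rw [sub_mem_germIdeal]
  filter_upwards [h, frameDomain_mem_nhds n x₀] with x hgx hx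
  rw [← lieDeriv_frame hx, ← hgx, sum_antidiagonal_mul_form hx, frameDet_frame, one_mul]

theorem coeff_derivative_densitySeries_apply (x₀ : M) (ρ : ℕ → TopForm n M) (m : ℕ) (x : M) :
    ((coeff m (PowerSeries.derivative (SmoothFun n M) (densitySeries x₀ ρ)) : SmoothFun n M) :
        M → ℂ) x
      = ((m : ℂ) + 1) * (density x₀ (ρ (m + 1)) : M → ℂ) x := by
  rw [PowerSeries.coeff_derivative, coeff_densitySeries, mul_comm, smoothFun_mul_apply]
  rfl

theorem exists_isLogDerivative (hρ : (ρ 0).form x₀ ≠ 0) : ∃ g, IsLogDerivative x₀ ρ g := by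
  obtain ⟨g, hg⟩ := exists_eventually_coeff_mul_eq (F := densitySeries x₀ ρ)
    (by simpa using density_ne_zero hρ)
    (PowerSeries.derivative (SmoothFun n M) (densitySeries x₀ ρ))
  refine ⟨g, ?_⟩
  filter_upwards [hg, frameDomain_mem_nhds n x₀] with x hgx hx m
  refine AlternatingMap.ext fun u => ?_
  simp only [alternatingMap_sum_apply, AlternatingMap.smul_apply, smul_eq_mul]
  rw [sum_antidiagonal_mul_form hx, hgx, coeff_derivative_densitySeries_apply, form_apply hx,
    mul_left_comm]

theorem IsLogDerivative.coeff_mul_densitySeries (h : IsLogDerivative x₀ ρ g) (m : ℕ) :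
    coeff m (g * densitySeries x₀ ρ)
      - coeff m (PowerSeries.derivative (SmoothFun n M) (densitySeries x₀ ρ))
        ∈ germIdeal n x₀ := by
  rw [sub_mem_germIdeal]
  filter_upwards [h, frameDomain_mem_nhds n x₀] with x hgx hx
  have on_frame := congrArg (fun f => f fun i => frame x₀ i x) (hgx m)
  simp only [alternatingMap_sum_apply, AlternatingMap.smul_apply, smul_eq_mul] at on_frame
  rw [sum_antidiagonal_mul_form hx, form_apply hx, frameDet_frame, one_mul, one_mul] at on_frame
  rw [on_frame, coeff_derivative_densitySeries_apply]

end Forms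

section LaurentSeriesPowers

variable {R S : Type*} [CommRing R] [CommRing S]

/-- The power `ν^m` of the formal variable. -/
def nuPow (R : Type*) [CommRing R] (m : ℤ) : R⸨X⸩ := HahnSeries.single m 1

theorem nuPow_mul_nuPow (a b : ℤ) : nuPow R a * nuPow R b = nuPow R (a + b) := by
  rw [nuPow, nuPow, HahnSeries.single_mul_single, mul_one, nuPow]

theorem nuPow_zero : nuPow R 0 = 1 := rfl

theorem nuPow_neg_one_mul_X : nuPow R (-1) * (X : R⟦X⟧) = 1 := by
  rw [PowerSeries.coe_X, ← nuPow, nuPow_mul_nuPow, neg_add_cancel, nuPow_zero]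

theorem nuPow_mul_X_pow (m : ℤ) (k : ℕ) :
    nuPow R m * (X : R⟦X⟧) ^ k = nuPow R (m + k) := by
  rw [PowerSeries.coe_X, HahnSeries.single_pow, one_pow, nsmul_one, ← nuPow, nuPow_mul_nuPow]

theorem nuPow_mul_eq_zero {m : ℤ} {f : R⸨X⸩} : nuPow R m * f = 0 ↔ f = 0 := by
  refine ⟨fun h => ?_, fun h => by rw [h, mul_zero]⟩
  rw [← one_mul f, ← nuPow_zero, ← neg_add_cancel m, ← nuPow_mul_nuPow, mul_assoc, h, mul_zero]

theorem coeff_nuPow_mul (m k : ℤ) (f : R⸨X⸩) : (nuPow R m * f).coeff k = f.coeff (k - m) := by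
  rw [nuPow, HahnSeries.coeff_single_mul, one_mul]

theorem exists_eq_nuPow_mul (f : R⸨X⸩) : ∃ (m : ℤ) (F : R⟦X⟧), f = nuPow R m * F :=
  ⟨_, _, f.single_order_mul_powerSeriesPart.symm⟩

theorem forall_laurentSeries_eq_zero_iff {T : R⸨X⸩ → S⸨X⸩} {U : R⟦X⟧ → S⟦X⟧} {k : ℤ}
    (hT : ∀ m (F : R⟦X⟧), T (nuPow R m * F) = nuPow S (m + k) * U F) :
    (∀ f, T f = 0) ↔ ∀ F, U F = 0 := by
  have shifted : ∀ m (F : R⟦X⟧), T (nuPow R m * F) = 0 ↔ U F = 0 := fun m F => by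
    rw [hT, nuPow_mul_eq_zero, map_eq_zero_iff _ HahnSeries.ofPowerSeries_injective]
  refine ⟨fun h F => (shifted 0 F).1 (h _), fun h f => ?_⟩
  obtain ⟨m, F, rfl⟩ := exists_eq_nuPow_mul f
  exact (shifted m F).2 (h F)

variable [Algebra S R]

theorem coeff_derivative (f : R⸨X⸩) (k : ℤ) :
    (LaurentSeries.derivative S f).coeff k = (k + 1) • f.coeff (k + 1) := by
  rw [LaurentSeries.derivative_apply, LaurentSeries.hasseDeriv_coeff, Nat.cast_one,
    Ring.choose_one_right]

theorem derivative_nuPow_mul (m : ℤ) (f : R⸨X⸩) :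
    LaurentSeries.derivative S (nuPow R m * f)
      = m • (nuPow R (m - 1) * f) + nuPow R m * LaurentSeries.derivative S f := by
  ext k
  rw [coeff_derivative, HahnSeries.coeff_add, HahnSeries.coeff_smul, coeff_nuPow_mul,
    coeff_nuPow_mul, coeff_nuPow_mul, coeff_derivative, show k - (m - 1) = k + 1 - m by ring,
    show k - m + 1 = k + 1 - m by ring, ← add_smul]
  congr 1
  ring

theorem derivative_coe (F : R⟦X⟧) :
    LaurentSeries.derivative S (F : R⸨X⸩) = (d⁄dX R F : R⟦X⟧) := by
  ext k
  rw [coeff_derivative, PowerSeries.coeff_coe, PowerSeries.coeff_coe]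
  rcases lt_trichotomy k (-1) with h | rfl | h
  · rw [if_pos (by lia), if_pos (by lia), smul_zero]
  · simp
  · obtain ⟨j, rfl⟩ := Int.eq_ofNat_of_zero_le (show 0 ≤ k by lia)
    rw [if_neg (by lia), if_neg (by lia), PowerSeries.coeff_derivative, zsmul_eq_mul, mul_comm]
    simp [show ((j : ℤ) + 1).natAbs = j + 1 by lia]

end LaurentSeriesPowers

section LaurentIntegrands

variable {𝕜 A : Type*} [Field 𝕜] [CommRing A] [Algebra 𝕜 A]

theorem nuPow_mul_assocIntegrand (D : Derivation 𝕜 A A) (Φ g F : A⟦X⟧) (m : ℤ) :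
    nuPow A m * seriesDer D F + (nuPow A (-1) * seriesDer D Φ + g) * (nuPow A m * F)
      = nuPow A (m + -1) * assocIntegrand D Φ g F := by
  simp only [assocIntegrand, map_add, map_mul]
  rw [← nuPow_mul_nuPow m]
  linear_combination (-nuPow A m * (seriesDer D F + g * F)) * nuPow_neg_one_mul_X (R := A)

theorem nuPow_mul_strongIntegrand (d : ℕ) (Φ g F : A⟦X⟧) (m : ℤ) :
    LaurentSeries.derivative 𝕜 (nuPow A m * (F : A⸨X⸩))
        + (LaurentSeries.derivative 𝕜 (nuPow A (-1) * (Φ : A⸨X⸩)) + (g : A⸨X⸩)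
          - nuPow A (-1) * (C (algebraMap 𝕜 A (d / 2)) : A⟦X⟧)) * (nuPow A m * (F : A⸨X⸩))
      = m • (nuPow A (m - 1) * (F : A⸨X⸩))
        + nuPow A (m + -2) * (strongIntegrand 𝕜 d Φ g F : A⸨X⸩) := by
  have neg_two : nuPow A (-2) = nuPow A (-1) ^ 2 := by rw [pow_two, nuPow_mul_nuPow]; rfl
  rw [derivative_nuPow_mul, derivative_nuPow_mul, derivative_coe, derivative_coe, neg_one_zsmul,
    add_assoc, show (-1 - 1 : ℤ) = -2 by rfl, ← nuPow_mul_nuPow m, neg_two]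
  simp only [strongIntegrand, map_add, map_sub, map_mul, map_pow]
  linear_combination (nuPow A m * (F : A⸨X⸩) * nuPow A (-1)
      * ((C (algebraMap 𝕜 A (d / 2)) : A⟦X⟧) - (d⁄dX A Φ : A⟦X⟧))
    - nuPow A m * ((d⁄dX A F : A⟦X⟧) + (g : A⸨X⸩) * F) * (1 + nuPow A (-1) * (X : A⟦X⟧)))
      * nuPow_neg_one_mul_X (R := A)

end LaurentIntegrands

section FormalFunctionals

variable {n : ℕ} {M : Type*} [TopologicalSpace M] [ChartedSpace (EuclideanSpace ℝ (Fin n)) M]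
  (L : FormalFunctional n M)

theorem coeff_act (f : (SmoothFun n M)⸨X⸩) (k : ℤ) :
    (act L f).coeff k = ∑ᶠ r : ℕ, L r (f.coeff (k - r)) := rfl

theorem act_add (f g : (SmoothFun n M)⸨X⸩) : act L (f + g) = act L f + act L g := by
  ext k
  rw [HahnSeries.coeff_add, coeff_act, coeff_act, coeff_act,
    ← finsum_add_distrib (finite_support_act L f k) (finite_support_act L g k)]
  simp only [HahnSeries.coeff_add, map_add]

theorem act_zsmul (m : ℤ) (f : (SmoothFun n M)⸨X⸩) : act L (m • f) = m • act L f :=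
  map_zsmul (AddMonoidHom.mk' (act L) (act_add L)) m f

theorem act_nuPow_mul (m : ℤ) (f : (SmoothFun n M)⸨X⸩) :
    act L (nuPow _ m * f) = nuPow ℂ m * act L f := by
  ext k
  rw [coeff_nuPow_mul, coeff_act, coeff_act]
  refine finsum_congr fun r => ?_
  rw [coeff_nuPow_mul, sub_right_comm]

theorem act_coe (F : (SmoothFun n M)⟦X⟧) :
    act L (F : (SmoothFun n M)⸨X⸩) = (seriesAct L F : ℂ⟦X⟧) := by
  have coeff_neg : ∀ k : ℤ, k < 0 → (F : (SmoothFun n M)⸨X⸩).coeff k = 0 := fun k hk => by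
    rw [PowerSeries.coeff_coe, if_pos hk]
  ext k
  rw [coeff_act, PowerSeries.coeff_coe]
  split_ifs with hk
  · refine finsum_eq_zero_of_forall_eq_zero fun r => ?_
    rw [coeff_neg _ (by lia), map_zero]
  · obtain ⟨k, rfl⟩ := Int.eq_ofNat_of_zero_le (not_lt.1 hk)
    rw [coeff_seriesAct, Finset.Nat.sum_antidiagonal_eq_sum_range_succ_mk, Int.natAbs_natCast,
      finsum_eq_sum_of_support_subset (s := Finset.range k.succ)]
    · refine Finset.sum_congr rfl fun r hr => ?_
      have hr := Finset.mem_range.1 hr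
      rw [PowerSeries.coeff_coe, if_neg (by lia), show ((k : ℤ) - r).natAbs = k - r by lia]
    · intro r hr
      contrapose! hr
      rw [Function.notMem_support, coeff_neg _ (by simp at hr; lia), map_zero]

/-- The formal power series `ν φ`. -/
def phaseSeries (φ : (SmoothFun n M)⸨X⸩) : (SmoothFun n M)⟦X⟧ :=
  PowerSeries.mk fun k => φ.coeff (k - 1)

variable {φ : (SmoothFun n M)⸨X⸩}

theorem nuPow_mul_phaseSeries (hφ : ∀ k : ℤ, k < -1 → φ.coeff k = 0) :
    nuPow _ (-1) * (phaseSeries φ : (SmoothFun n M)⸨X⸩) = φ := by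
  ext1
  funext k
  rw [coeff_nuPow_mul, PowerSeries.coeff_coe]
  split_ifs with h
  · rw [hφ k (by lia)]
  · rw [phaseSeries, PowerSeries.coeff_mk]
    congr 1
    lia

theorem differentiation_iff (hφ : ∀ k : ℤ, k < -1 → φ.coeff k = 0) (g : (SmoothFun n M)⟦X⟧) :
    (∀ f, LaurentSeries.derivative ℂ (act L f)
        - act L (LaurentSeries.derivative ℂ f
            + (LaurentSeries.derivative ℂ φ + HahnSeries.ofPowerSeries ℤ _ g
                - halfDimOverNu n M) * f) = 0) ↔
      ∀ F, X ^ 2 * d⁄dX ℂ (seriesAct L F)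
        = seriesAct L (strongIntegrand ℂ n (phaseSeries φ) g F) := by
  have halfDim_eq : halfDimOverNu n M = nuPow (SmoothFun n M) (-1)
      * (C (algebraMap ℂ (SmoothFun n M) (n / 2)) : (SmoothFun n M)⟦X⟧) := by
    rw [PowerSeries.coe_C, HahnSeries.C_apply, nuPow, HahnSeries.single_mul_single, one_mul,
      add_zero, halfDimOverNu]
  simp only [← sub_eq_zero (a := X ^ 2 * d⁄dX ℂ (seriesAct L _))]
  refine forall_laurentSeries_eq_zero_iff (k := -2) fun m F => ?_
  have two_shifts : nuPow ℂ m = nuPow ℂ (m + -2) * ((X ^ 2 : ℂ⟦X⟧) : ℂ⸨X⸩) := by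
    rw [map_pow, nuPow_mul_X_pow]; norm_num
  conv_lhs => rw [← nuPow_mul_phaseSeries hφ, halfDim_eq]
  rw [nuPow_mul_strongIntegrand, act_add, act_zsmul, act_nuPow_mul, act_nuPow_mul, act_nuPow_mul,
    act_coe, act_coe, derivative_nuPow_mul, derivative_coe, add_sub_add_left_eq_sub, two_shifts,
    mul_assoc, ← map_mul, ← mul_sub, ← map_sub]

variable [IsManifold (𝓡 n) ∞ M]

theorem vfApplyFormal_nuPow_mul (v : SmoothVF n M) (m : ℤ) (F : (SmoothFun n M)⟦X⟧) :
    vfApplyFormal v (nuPow _ m * (F : (SmoothFun n M)⸨X⸩))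
      = nuPow _ m * (seriesDer (vfDer v) F : (SmoothFun n M)⸨X⸩) := by
  ext1
  funext k
  rw [vfApplyFormal, HahnSeries.map_coeff, coeff_nuPow_mul, coeff_nuPow_mul, PowerSeries.coeff_coe,
    PowerSeries.coeff_coe]
  split_ifs
  · exact map_zero _
  · rw [coeff_seriesDer, vfDer_apply]

theorem integration_by_parts_iff (hφ : ∀ k : ℤ, k < -1 → φ.coeff k = 0) (v : SmoothVF n M)
    (g : (SmoothFun n M)⟦X⟧) :
    (∀ f, act L (vfApplyFormal v f
        + (vfApplyFormal v φ + HahnSeries.ofPowerSeries ℤ (SmoothFun n M) g) * f) = 0) ↔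
      ∀ F, seriesAct L (assocIntegrand (vfDer v) (phaseSeries φ) g F) = 0 := by
  refine forall_laurentSeries_eq_zero_iff (k := -1) fun m F => ?_
  conv_lhs => rw [← nuPow_mul_phaseSeries hφ]
  rw [vfApplyFormal_nuPow_mul, vfApplyFormal_nuPow_mul, nuPow_mul_assocIntegrand, act_nuPow_mul,
    act_coe]

end FormalFunctionals

section PointFrame

variable {n : ℕ} {M : Type*} [TopologicalSpace M] [ChartedSpace (EuclideanSpace ℝ (Fin n)) M]

theorem coeff_zero_phaseSeries (φ : (SmoothFun n M)⸨X⸩) :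
    coeff 0 (phaseSeries φ) = φ.coeff (-1) := by
  rw [phaseSeries, PowerSeries.coeff_mk]
  rfl

variable [IsManifold (𝓡 n) ∞ M] {x₀ : M} {φ : (SmoothFun n M)⸨X⸩}

theorem isStrongFOI_iff (hφ : IsFormalPhase x₀ φ) (ρ : ℕ → TopForm n M)
    (L : FormalFunctional n M) : IsStrongFOI x₀ φ ρ L ↔
      (∀ r, IsPointDistribution x₀ (L r)) ∧ L 0 ≠ 0 ∧
      (∀ v g, IsDivergence x₀ ρ v g →
        ∀ F, seriesAct L (assocIntegrand (vfDer v) (phaseSeries φ) g F) = 0) ∧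
      ∀ g, IsLogDerivative x₀ ρ g → ∀ F, X ^ 2 * d⁄dX ℂ (seriesAct L F)
        = seriesAct L (strongIntegrand ℂ n (phaseSeries φ) g F) := by
  simp only [← integration_by_parts_iff L hφ.coeff_eq_zero,
    ← differentiation_iff L hφ.coeff_eq_zero]
  exact ⟨fun h => ⟨h.distribution, h.leading_ne_zero, h.integration_by_parts, h.differentiation⟩,
    fun ⟨distribution, leading_ne_zero, integration_by_parts, differentiation⟩ =>
      ⟨⟨distribution, leading_ne_zero, integration_by_parts⟩, differentiation⟩⟩

variable [T2Space M]

/-- The coordinate frame at `x₀`. -/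
def pointFrame (x₀ : M) : FormalFrame ℂ (Fin n) (SmoothFun n M) where
  der i := vfDer (frame x₀ i)
  ev := evalAt x₀
  null := germIdeal n x₀
  der_mem i _ hf := vfApply_mem_germIdeal (frame x₀ i) hf
  ev_null _ hf := hf.self_of_nhds
  comm i j f := by
    refine sub_mem_germIdeal.2 ?_
    filter_upwards [frameDomain_mem_nhds n x₀] with x hx
    exact vfApply_frame_comm hx i j f

theorem frameHessian_pointFrame (f : SmoothFun n M) :
    frameHessian (pointFrame x₀) f = hessian x₀ f := by
  ext i j
  exact vfApply_frame_frame (mem_frameDomain n x₀) i j f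

theorem IsFormalPhase.isPhase (hφ : IsFormalPhase x₀ φ) :
    IsPhase (pointFrame x₀) (phaseSeries φ) where
  ev_eq_zero := by
    rw [coeff_zero_phaseSeries]
    exact hφ.critical_value
  ev_der_eq_zero i := by
    rw [coeff_zero_phaseSeries]
    change (vfApply (frame x₀ i) (φ.coeff (-1)) : M → ℂ) x₀ = 0
    rw [vfApply_apply, hφ.critical.1]
    rfl
  isUnit_det := by
    rw [coeff_zero_phaseSeries, frameHessian_pointFrame]
    exact hφ.critical.2

theorem isCombination_coord (v : SmoothVF n M) :
    IsCombination (pointFrame x₀) (vfDer v) (coord x₀ v) := by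
  refine fun f => sub_mem_germIdeal.2 ?_
  filter_upwards [frameDomain_mem_nhds n x₀] with x hx
  rw [smoothFun_sum_apply]
  exact vfApply_eq_sum hx v f

theorem IsDivergence.isSeriesDivergence {ρ : ℕ → TopForm n M} {v : SmoothVF n M}
    {g : (SmoothFun n M)⟦X⟧} (hg : IsDivergence x₀ ρ v g) :
    IsSeriesDivergence (pointFrame x₀) (densitySeries x₀ ρ) (coord x₀ v) g := fun m => by
  rw [coeff_densitySeries]
  exact hg.coeff_mul_densitySeries m

theorem norm_iteratedFDeriv_vfApply_frame_le (x₀ : M) (i : Fin n) (f : SmoothFun n M) (j : ℕ) :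
    ‖iteratedFDeriv ℝ j (inChart (n := n) x₀ (vfApply (frame x₀ i) f)) (extChartAt (𝓡 n) x₀ x₀)‖
      ≤ ‖iteratedFDeriv ℝ (j + 1) (inChart (n := n) x₀ f) (extChartAt (𝓡 n) x₀ x₀)‖ := by
  have smooth : ContDiffAt ℝ ∞ (fderiv ℝ (inChart (n := n) x₀ f)) (extChartAt (𝓡 n) x₀ x₀) :=
    (contDiffAt_inChart x₀ f (mem_extChartAt_target x₀)).fderiv_right (by simp)
  rw [((inChart_vfApply_frame_eventuallyEq (mem_frameDomain n x₀) i f).iteratedFDeriv ℝ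
    j).self_of_nhds, ← norm_iteratedFDeriv_fderiv]
  refine (norm_iteratedFDeriv_clm_apply_const smooth (WithTop.coe_le_coe.2 le_top)).trans_eq ?_
  rw [PiLp.norm_single, norm_one, one_mul]

theorem exists_norm_taylorCoeff_le (x₀ : M) (d : ℕ) (m : MvPolynomial (Fin n) ℂ →ₗ[ℂ] ℂ) :
    ∃ c : ℝ, ∀ (f : SmoothFun n M) (B : ℝ),
      (∀ j ≤ d, ‖iteratedFDeriv ℝ j (inChart (n := n) x₀ f) (extChartAt (𝓡 n) x₀ x₀)‖ ≤ B) →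
      ‖m (taylorCoeff (pointFrame x₀) d f)‖ ≤ c * B := by
  induction d generalizing m with
  | zero =>
    refine ⟨‖m 1‖, fun f B hB => ?_⟩
    have norm_value_le := hB 0 le_rfl
    rw [norm_iteratedFDeriv_zero, inChart_extChartAt (mem_extChartAt_source x₀)] at norm_value_le
    have C_value : MvPolynomial.C ((pointFrame x₀).ev f)
        = ((f : M → ℂ) x₀) • (1 : MvPolynomial (Fin n) ℂ) := by
      rw [MvPolynomial.smul_eq_C_mul, mul_one]
      rfl
    rw [taylorCoeff_zero, C_value, map_smul, norm_smul, mul_comm]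
    gcongr
  | succ d ih =>
    choose c hc using fun i => ih (m ∘ₗ LinearMap.mulLeft ℂ (MvPolynomial.X i))
    refine ⟨‖((d : ℂ) + 1)⁻¹‖ * ∑ i, c i, fun f B hB => ?_⟩
    rw [taylorCoeff_succ, map_smul, norm_smul, mul_assoc, map_sum, Finset.sum_mul]
    gcongr
    refine norm_sum_le_of_le _ fun i _ => hc i _ B fun j hj => ?_
    exact (norm_iteratedFDeriv_vfApply_frame_le x₀ i f j).trans (hB (j + 1) (by lia))

theorem isPointDistribution_of_eq_sum_taylorCoeff {L : SmoothFun n M →ₗ[ℂ] ℂ} {N : ℕ}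
    {m : ℕ → MvPolynomial (Fin n) ℂ →ₗ[ℂ] ℂ}
    (hL : ∀ f, L f = ∑ b ∈ Finset.range N, m b (taylorCoeff (pointFrame x₀) b f)) :
    IsPointDistribution x₀ L where
  support f hf := by
    rw [hL]
    exact Finset.sum_eq_zero fun b _ => by
      rw [taylorCoeff_null (pointFrame x₀) b hf, map_zero]
  continuous := by
    choose c hc using fun b => exists_norm_taylorCoeff_le x₀ b (m b)
    refine ⟨{extChartAt (𝓡 n) x₀ x₀}, N, ∑ b ∈ Finset.range N, c b, isCompact_singleton,
      Set.singleton_subset_iff.2 (mem_extChartAt_target x₀), fun f B _ hB => ?_⟩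
    rw [hL, Finset.sum_mul]
    refine norm_sum_le_of_le _ fun b hb => hc b f B fun j hj => hB j ?_ _ rfl
    exact hj.trans (Finset.mem_range.1 hb).le

end PointFrame

section Existence

variable {n : ℕ} {M : Type*} [TopologicalSpace M] [ChartedSpace (EuclideanSpace ℝ (Fin n)) M]
  [IsManifold (𝓡 n) ∞ M] [T2Space M] {x₀ : M} {φ : (SmoothFun n M)⸨X⸩} {ρ : ℕ → TopForm n M}

/-- The formal stationary phase expansion at `x₀` of the integral of `e^φ f ρ`. -/
def stationaryPhase (x₀ : M) (φ : (SmoothFun n M)⸨X⸩) (ρ : ℕ → TopForm n M) :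
    FormalFunctional n M :=
  formalComponents (pointFrame x₀) (formalIntegral (pointFrame x₀) (phaseSeries φ))
    (densitySeries x₀ ρ)

theorem seriesAct_stationaryPhase (F : (SmoothFun n M)⟦X⟧) :
    seriesAct (stationaryPhase x₀ φ ρ) F
      = formalIntegral (pointFrame x₀) (phaseSeries φ)
        (rescale (pointFrame x₀) (densitySeries x₀ ρ * F)) :=
  seriesAct_formalComponents formalIntegral_X_sq_mul _ F

theorem stationaryPhase_zero :
    stationaryPhase x₀ φ ρ 0 = (density x₀ (ρ 0) : M → ℂ) x₀ • dirac x₀ := by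
  ext f
  rw [← coeff_seriesAct_C, seriesAct_stationaryPhase, coeff_zero_formalIntegral_rescale,
    PowerSeries.coeff_mul_C, coeff_densitySeries]
  rfl

theorem stationaryPhase_eq_zero {f : SmoothFun n M} (hf : taylor (pointFrame x₀) f = 0) (r : ℕ) :
    stationaryPhase x₀ φ ρ r f = 0 := by
  simp only [stationaryPhase, formalComponents, LinearMap.comp_apply, hf, map_zero]

theorem isPointDistribution_stationaryPhase (r : ℕ) :
    IsPointDistribution x₀ (stationaryPhase x₀ φ ρ r) := by
  obtain ⟨m, hm⟩ := coeff_formalIntegral_mul_taylor (K := pointFrame x₀) (Φ := phaseSeries φ)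
    (rescale (pointFrame x₀) (densitySeries x₀ ρ)) r
  exact isPointDistribution_of_eq_sum_taylorCoeff hm

theorem isStrongFOI_stationaryPhase (hφ : IsFormalPhase x₀ φ) (hρ : (ρ 0).form x₀ ≠ 0) :
    IsStrongFOI x₀ φ ρ (stationaryPhase x₀ φ ρ) := by
  refine (isStrongFOI_iff hφ ρ _).2 ⟨isPointDistribution_stationaryPhase, fun leading_eq_zero => ?_,
    fun v g hg F => ?_, fun g hg F => ?_⟩
  · have := LinearMap.congr_fun (stationaryPhase_zero.symm.trans leading_eq_zero) 1
    exact density_ne_zero hρ (by simpa [dirac] using this)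
  · rw [seriesAct_stationaryPhase]
    exact hφ.isPhase.formalIntegral_associated (isCombination_coord v)
      hg.isSeriesDivergence F
  · rw [seriesAct_stationaryPhase, seriesAct_stationaryPhase,
      hφ.isPhase.X_sq_mul_derivative_formalIntegral hg.coeff_mul_densitySeries, Fintype.card_fin]

end Existence

section Hadamard

open MeasureTheory Set

theorem contDiff_unitInterval_integral {P F : Type*} [NormedAddCommGroup P] [NormedSpace ℝ P]
    [NormedAddCommGroup F] [NormedSpace ℝ F] [CompleteSpace F] {m : ℕ∞} {a : P × ℝ → F}
    (ha : ContDiff ℝ m a) : ContDiff ℝ m fun p => ∫ t in (0 : ℝ)..1, a (p, t) := by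
  -- With a cutoff `χ` equal to `1` on `[0, 1]`, the integral is the value at `0` of the
  -- convolution of the indicator of `(0, 1]` with the compactly supported `t ↦ χ (-t) a (p, -t)`.
  let χ : ContDiffBump (0 : ℝ) := ⟨1, 2, one_pos, one_lt_two⟩
  let K : P → ℝ → F := fun p t => χ (-t) • a (p, -t)
  have hK : ContDiff ℝ m ↿K :=
    (χ.contDiff.comp contDiff_snd.neg).smul
      (ha.comp (contDiff_fst.prodMk contDiff_snd.neg))
  have K_eq_zero (p : P) (t : ℝ) (ht : t ∉ Metric.closedBall (0 : ℝ) 2) : K p t = 0 := by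
    have : χ (-t) = 0 := χ.zero_of_le_dist (by 
      rw [Metric.mem_closedBall, not_le] at ht
      simpa using ht.le)
    simp only [K, this, zero_smul]
  have contDiff_convolution := contDiffOn_convolution_right_with_param_comp (μ := volume)
    (ContinuousLinearMap.lsmul ℝ ℝ : ℝ →L[ℝ] F →L[ℝ] F) (v := fun _ : P => (0 : ℝ))
    contDiffOn_const isOpen_univ (isCompact_closedBall (0 : ℝ) 2) (fun p t _ => K_eq_zero p t)
    (f := (Ioc (0 : ℝ) 1).indicator fun _ => (1 : ℝ))
    ((locallyIntegrable_const 1).indicator measurableSet_Ioc) hK.contDiffOn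
  convert! contDiffOn_univ.1 contDiff_convolution using 2 with p
  rw [intervalIntegral.integral_of_le zero_le_one, ← integral_indicator measurableSet_Ioc]
  refine integral_congr_ae (Filter.Eventually.of_forall fun t => ?_)
  by_cases ht : t ∈ Ioc (0 : ℝ) 1
  · have : χ t = 1 := χ.one_of_mem_closedBall (by simpa [abs_of_pos ht.1] using ht.2)
    simp [K, ht, this]
  · simp [ht]

theorem exists_contDiff_eq_add_clm_sub {E G : Type*} [NormedAddCommGroup E] [NormedSpace ℝ E]
    [NormedAddCommGroup G] [NormedSpace ℝ G] [CompleteSpace G] {F : E → G}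
    (hF : ContDiff ℝ ∞ F) (p : E) :
    ∃ h : E → E →L[ℝ] G, ContDiff ℝ ∞ h ∧ ∀ y, F y = F p + h y (y - p) := by
  have contDiff_fderiv : ContDiff ℝ ∞ fun q : E × ℝ => fderiv ℝ F (p + q.2 • (q.1 - p)) :=
    (hF.fderiv_right (m := ∞) (by simp)).comp
      (contDiff_const.add (contDiff_snd.smul (contDiff_fst.sub contDiff_const)))
  refine ⟨fun y => ∫ t in (0 : ℝ)..1, fderiv ℝ F (p + t • (y - p)),
    contDiff_unitInterval_integral contDiff_fderiv, fun y => ?_⟩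
  have continuous_fderiv : Continuous fun t : ℝ => fderiv ℝ F (p + t • (y - p)) :=
    contDiff_fderiv.continuous.comp (continuous_const.prodMk continuous_id)
  have hasDerivAt (t : ℝ) : HasDerivAt (fun t : ℝ => F (p + t • (y - p)))
      (fderiv ℝ F (p + t • (y - p)) (y - p)) t :=
    (hF.differentiable (by simp) _).hasFDerivAt.comp_hasDerivAt t
      (by simpa using ((hasDerivAt_id t).smul_const (y - p)).const_add p)
  rw [ContinuousLinearMap.intervalIntegral_apply (continuous_fderiv.intervalIntegrable 0 1),
    intervalIntegral.integral_eq_sub_of_hasDerivAt (fun t _ => hasDerivAt t)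
      ((continuous_fderiv.clm_apply continuous_const).intervalIntegrable 0 1)]
  simp

theorem exists_contDiff_eventuallyEq {E G : Type*} [NormedAddCommGroup E] [NormedSpace ℝ E]
    [HasContDiffBump E] [NormedAddCommGroup G] [NormedSpace ℝ G] {F : E → G} {U : Set E}
    (hU : IsOpen U) (hF : ∀ y ∈ U, ContDiffAt ℝ ∞ F y) {p : E} (hp : p ∈ U) :
    ∃ G : E → G, ContDiff ℝ ∞ G ∧ G =ᶠ[𝓝 p] F := by
  obtain ⟨ε, hε, hball⟩ := Metric.nhds_basis_closedBall.mem_iff.1 (hU.mem_nhds hp)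
  let χ : ContDiffBump p := ⟨ε / 2, ε, half_pos hε, half_lt_self hε⟩
  refine ⟨fun y => χ y • F y, ?_, ?_⟩
  · refine (contMDiff_of_tsupport fun y hy => ?_).contDiff
    have hy' : y ∈ tsupport χ := tsupport_smul_subset_left _ _ hy
    rw [χ.tsupport_eq] at hy'
    exact (χ.contDiffAt.smul (hF y (hball hy'))).contMDiffAt
  · filter_upwards [χ.eventuallyEq_one] with y hy
    rw [hy, Pi.one_apply, one_smul]

end Hadamard

section CriticalPoints

theorem exists_dotProduct_sub_mem {R ι : Type*} [CommRing R] [Fintype ι] [DecidableEq ι]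
    {I : Ideal R} {A : Matrix ι ι R} {φ ξ : ι → R} (hφ : ∀ k, φ k - (A.mulVec ξ) k ∈ I) {d : R}
    (hd : A.det * d - 1 ∈ I) (g : ι → R) : ∃ h : ι → R, dotProduct ξ g - dotProduct φ h ∈ I := by
  refine ⟨d • Matrix.vecMul g A.adjugate, ?_⟩
  have adjugate_mulVec : dotProduct (A.mulVec ξ) (d • Matrix.vecMul g A.adjugate)
      = A.det * d * dotProduct ξ g := by
    rw [dotProduct_smul, dotProduct_comm, ← Matrix.dotProduct_mulVec, Matrix.mulVec_mulVec,
      Matrix.adjugate_mul, Matrix.smul_mulVec, Matrix.one_mulVec, dotProduct_smul,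
      dotProduct_comm ξ, smul_eq_mul, smul_eq_mul]
    ring
  have : dotProduct ξ g - dotProduct φ (d • Matrix.vecMul g A.adjugate)
      = -((A.det * d - 1) * dotProduct ξ g)
        - dotProduct (φ - A.mulVec ξ) (d • Matrix.vecMul g A.adjugate) := by
    rw [sub_dotProduct, adjugate_mulVec]
    ring
  rw [this]
  exact I.sub_mem (I.neg_mem (I.mul_mem_right _ hd))
    (I.sum_mem fun k _ => I.mul_mem_right _ (hφ k))

variable {n : ℕ} {M : Type*} [TopologicalSpace M] [ChartedSpace (EuclideanSpace ℝ (Fin n)) M]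
  [IsManifold (𝓡 n) ∞ M] [T2Space M]

theorem exists_smoothFun_eq_comp_extChartAt (x₀ : M) {G : EuclideanSpace ℝ (Fin n) → ℂ}
    (hG : ContDiff ℝ ∞ G) :
    ∃ f : SmoothFun n M, ∀ x ∈ frameDomain n x₀, (f : M → ℂ) x = G (extChartAt (𝓡 n) x₀ x) :=
  exists_smoothFun_eq_on_frameDomain (g := fun x => G (extChartAt (𝓡 n) x₀ x))
    (hG.contMDiff.comp_contMDiffOn contMDiffOn_extChartAt)

theorem exists_coordinates (x₀ : M) : ∃ ξ : Fin n → SmoothFun n M,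
    (∀ j, (ξ j : M → ℂ) x₀ = 0) ∧
    ∀ f : SmoothFun n M, ∃ h : Fin n → SmoothFun n M,
      f - (algebraMap ℂ (SmoothFun n M) ((f : M → ℂ) x₀) + ∑ j, ξ j * h j) ∈ germIdeal n x₀ := by
  choose ξ hξ using fun j => exists_smoothFun_eq_comp_extChartAt x₀
    (G := fun y : EuclideanSpace ℝ (Fin n) => ((y j - extChartAt (𝓡 n) x₀ x₀ j : ℝ) : ℂ))
    (Complex.ofRealCLM.contDiff.comp (ContDiff.sub (by fun_prop) contDiff_const))
  refine ⟨ξ, fun j => by rw [hξ j _ (mem_frameDomain n x₀), sub_self, Complex.ofReal_zero],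
    fun f => ?_⟩
  obtain ⟨F, hF, hFf⟩ := exists_contDiff_eventuallyEq (isOpen_extChartAt_target x₀)
    (fun y hy => contDiffAt_inChart x₀ f hy) (mem_extChartAt_target (I := 𝓡 n) x₀)
  obtain ⟨h, hh, hFh⟩ := exists_contDiff_eq_add_clm_sub hF (extChartAt (𝓡 n) x₀ x₀)
  choose H hH using fun j => exists_smoothFun_eq_comp_extChartAt x₀
    (hh.clm_apply (contDiff_const (c := EuclideanSpace.single j (1 : ℝ))))
  refine ⟨H, sub_mem_germIdeal.2 ?_⟩
  filter_upwards [frameDomain_mem_nhds n x₀,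
    (continuousAt_extChartAt x₀).eventually hFf] with x hx F_eq
  have hx₀ := frameDomain_subset_extChartAt_source x₀ (mem_frameDomain n x₀)
  rw [inChart_extChartAt (frameDomain_subset_extChartAt_source x₀ hx)] at F_eq
  have value_x₀ : F (extChartAt (𝓡 n) x₀ x₀) = (f : M → ℂ) x₀ := by
    rw [hFf.self_of_nhds, inChart_extChartAt hx₀]
  have expand (y : EuclideanSpace ℝ (Fin n)) (T : EuclideanSpace ℝ (Fin n) →L[ℝ] ℂ) :
      T y = ∑ j, (y j : ℂ) * T (EuclideanSpace.single j 1) := by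
    conv_lhs => rw [← (EuclideanSpace.basisFun (Fin n) ℝ).sum_repr y]
    simp
  rw [← F_eq, hFh, value_x₀, expand]
  simp only [smoothFun_add_apply, smoothFun_sum_apply, smoothFun_mul_apply]
  congr 1
  exact Finset.sum_congr rfl fun j _ => by rw [hξ j x hx, hH j x hx]; rfl

theorem IsNondegenerateCritical.det_apply_ne_zero {x₀ : M} {ψ : SmoothFun n M}
    (hψ : IsNondegenerateCritical x₀ ψ) {ξ : Fin n → SmoothFun n M}
    (hξ : ∀ j, (ξ j : M → ℂ) x₀ = 0) {A : Matrix (Fin n) (Fin n) (SmoothFun n M)}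
    (hA : ∀ k, vfApply (frame x₀ k) ψ - (A.mulVec ξ) k ∈ germIdeal n x₀) :
    (A.det : M → ℂ) x₀ ≠ 0 := by
  have hessian_eq : hessian x₀ ψ
      = Matrix.of (fun i j => (vfApply (frame x₀ i) (ξ j) : M → ℂ) x₀)
        * (Matrix.of fun k j => (A k j : M → ℂ) x₀).transpose := by
    ext i k
    rw [← frameHessian_pointFrame]
    change (vfApply (frame x₀ i) (vfApply (frame x₀ k) ψ) : M → ℂ) x₀ = _
    rw [vfApply_congr (n := n) (frame x₀ i) (sub_mem_germIdeal.1 (hA k)), Matrix.mul_apply]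
    change (vfApply (frame x₀ i) (∑ j, A k j * ξ j) : M → ℂ) x₀ = _
    rw [map_sum, smoothFun_sum_apply]
    refine Finset.sum_congr rfl fun j _ => ?_
    rw [vfApply_mul, smoothFun_add_apply, smoothFun_mul_apply, smoothFun_mul_apply, hξ,
      zero_mul, add_zero, mul_comm]
    rfl
  have hdet := hψ.2.ne_zero
  rw [hessian_eq, Matrix.det_mul, Matrix.det_transpose, ← smoothFun_det_apply] at hdet
  exact right_ne_zero_of_mul hdet

theorem IsNondegenerateCritical.exists_eq_sum_frame_mul {x₀ : M} {ψ : SmoothFun n M}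
    (hψ : IsNondegenerateCritical x₀ ψ) (f : SmoothFun n M) :
    ∃ h : Fin n → SmoothFun n M, f - (algebraMap ℂ (SmoothFun n M) ((f : M → ℂ) x₀)
      + ∑ k, vfApply (frame x₀ k) ψ * h k) ∈ germIdeal n x₀ := by
  obtain ⟨ξ, hξ, hξh⟩ := exists_coordinates (n := n) x₀
  have frame_apply_eq_zero (k : Fin n) : (vfApply (frame x₀ k) ψ : M → ℂ) x₀ = 0 := by
    rw [vfApply_apply, hψ.1]
    rfl
  choose A hA using fun k => hξh (vfApply (frame x₀ k) ψ)
  have hA (k) : vfApply (frame x₀ k) ψ - ((Matrix.of A).mulVec ξ) k ∈ germIdeal n x₀ := by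
    simpa only [frame_apply_eq_zero, map_zero, zero_add, mul_comm (ξ _), Matrix.mulVec,
      dotProduct, Matrix.of_apply] using hA k
  obtain ⟨d, hd⟩ := exists_eventually_mul_eq_one
    (hψ.det_apply_ne_zero hξ hA)
  obtain ⟨g, hg⟩ := hξh f
  obtain ⟨h, hh⟩ := exists_dotProduct_sub_mem hA (sub_mem_germIdeal.2 hd) g
  refine ⟨h, ?_⟩
  convert add_mem hg hh using 1
  simp only [dotProduct]
  abel

end CriticalPoints

section SeriesActionUniqueness

variable {𝕜 A : Type*} [Field 𝕜] [CommRing A] [Algebra 𝕜 A] {L L' : ℕ → A →ₗ[𝕜] 𝕜}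

theorem exists_eq_seriesAct {T : A⟦X⟧ →ₗ[𝕜] 𝕜⟦X⟧} (hT : ∀ F, T (X * F) = X * T F) :
    ∃ K : ℕ → A →ₗ[𝕜] 𝕜, T = seriesAct K := by
  let K : ℕ → A →ₗ[𝕜] 𝕜 := fun k =>
    coeff k ∘ₗ T ∘ₗ (PowerSeries.monomial (R := A) 0).restrictScalars 𝕜
  have leading (f : A) : seriesAct K (C f) = T (C f) := by
    ext1 k
    rw [coeff_seriesAct_C, ← PowerSeries.monomial_zero_eq_C_apply]
    rfl
  refine ⟨K, LinearMap.ext fun F => ?_⟩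
  refine eq_of_sub_eq_X_pow_mul (L := T) (R := seriesAct K) one_ne_zero shift (fun F => ?_) F
  rw [seriesAct_eq, leading]
  conv_lhs => rw [eq_C_add_X_mul_shift F, map_add, hT]
  simp only [← eq_C_add_X_mul_shift F]
  ring

theorem coeff_seriesAct_of_forall_lt {r : ℕ} (h : ∀ a < r, L a = 0) (F : A⟦X⟧) :
    coeff r (seriesAct L F) = L r (coeff 0 F) := by
  rw [coeff_seriesAct, Finset.sum_eq_single (r, 0)]
  · rintro ⟨a, b⟩ hp hb
    have hp : a + b = r := by simpa using hp
    have hb : b ≠ 0 := by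
      rintro rfl
      exact hb (by rw [← hp, add_zero])
    rw [h a (by omega), LinearMap.zero_apply]
  · simp

theorem coeff_zero_seriesAct (F : A⟦X⟧) : coeff 0 (seriesAct L F) = L 0 (coeff 0 F) :=
  coeff_seriesAct_of_forall_lt (by simp) F

theorem seriesAct_smul (c : 𝕜) (F : A⟦X⟧) : seriesAct (c • L) F = c • seriesAct L F := by
  ext1 k
  rw [PowerSeries.coeff_smul, coeff_seriesAct, coeff_seriesAct, Finset.smul_sum]
  rfl

variable {ι : Type*} {D : ι → Derivation 𝕜 A A} {Φ : A⟦X⟧} {g : ι → A⟦X⟧}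

theorem eq_zero_of_seriesAct_assocIntegrand [Fintype ι] {I : Ideal A}
    (decomposition : ∀ f, ∃ (a : 𝕜) (h : ι → A),
      f - (algebraMap 𝕜 A a + ∑ i, D i (coeff 0 Φ) * h i) ∈ I)
    (hI : ∀ r, ∀ f ∈ I, L r f = 0)
    (hL : ∀ i F, seriesAct L (assocIntegrand (D i) Φ (g i) F) = 0)
    (hone : seriesAct L 1 = 0) : L = 0 := by
  ext1 r
  induction r using Nat.strong_induction_on with
  | _ r ih =>
    have critical_mul (i : ι) (f : A) : L r (D i (coeff 0 Φ) * f) = 0 := by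
      simpa [assocIntegrand, coeff_seriesAct_of_forall_lt ih, PowerSeries.coeff_zero_X_mul,
        -PowerSeries.coeff_zero_eq_constantCoeff] using congrArg (coeff r) (hL i (C f))
    have one : L r 1 = 0 := by
      rw [← coeff_seriesAct_C L, map_one, hone, map_zero]
    ext f
    obtain ⟨a, h, hf⟩ := decomposition f
    simpa [critical_mul, one, Algebra.algebraMap_eq_smul_one,
      -PowerSeries.coeff_zero_eq_constantCoeff] using hI r _ hf

theorem exists_seriesAct_eq_mul [Fintype ι] {I : Ideal A}
    (decomposition : ∀ f, ∃ (a : 𝕜) (h : ι → A),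
      f - (algebraMap 𝕜 A a + ∑ i, D i (coeff 0 Φ) * h i) ∈ I)
    (hI : ∀ r, ∀ f ∈ I, L r f = 0) (hI' : ∀ r, ∀ f ∈ I, L' r f = 0)
    (hL : ∀ i F, seriesAct L (assocIntegrand (D i) Φ (g i) F) = 0)
    (hL' : ∀ i F, seriesAct L' (assocIntegrand (D i) Φ (g i) F) = 0) (hone : L 0 1 ≠ 0) :
    ∃ c : 𝕜⟦X⟧, ∀ F, seriesAct L' F = c * seriesAct L F := by
  have mul_inv_cancel : seriesAct L 1 * (seriesAct L 1)⁻¹ = 1 := by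
    refine PowerSeries.mul_inv_cancel _ ?_
    rwa [← PowerSeries.coeff_zero_eq_constantCoeff_apply, coeff_zero_seriesAct,
      PowerSeries.coeff_zero_one]
  let c : 𝕜⟦X⟧ := seriesAct L' 1 * (seriesAct L 1)⁻¹
  obtain ⟨K, hK⟩ := exists_eq_seriesAct
    (T := seriesAct L' - LinearMap.mulLeft 𝕜 c ∘ₗ seriesAct L) fun F => by
      simp only [LinearMap.sub_apply, LinearMap.comp_apply, LinearMap.mulLeft_apply,
        seriesAct_X_mul]
      ring
  have seriesAct_K (F : A⟦X⟧) : seriesAct K F = seriesAct L' F - c * seriesAct L F := by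
    rw [← hK]
    rfl
  have seriesAct_C_eq_zero {Λ : ℕ → A →ₗ[𝕜] 𝕜} (hΛ : ∀ r, ∀ f ∈ I, Λ r f = 0) {f : A}
      (hf : f ∈ I) : seriesAct Λ (C f) = 0 := by
    ext1 k
    rw [coeff_seriesAct_C, hΛ k f hf, map_zero]
  have K_eq_zero : K = 0 := by
    refine eq_zero_of_seriesAct_assocIntegrand (g := g) decomposition (fun r f hf => ?_)
      (fun i F => ?_) ?_
    · rw [← coeff_seriesAct_C K, seriesAct_K, seriesAct_C_eq_zero hI hf,
        seriesAct_C_eq_zero hI' hf, mul_zero, sub_zero, map_zero]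
    · rw [seriesAct_K, hL, hL', mul_zero, sub_zero]
    · rw [seriesAct_K, mul_assoc, mul_comm _ (seriesAct L 1), mul_inv_cancel, mul_one, sub_self]
  refine ⟨c, fun F => ?_⟩
  rw [← sub_eq_zero, ← seriesAct_K, K_eq_zero]
  ext1 k
  simp [coeff_seriesAct]

theorem eq_smul_of_seriesAct_strongIntegrand [CharZero 𝕜] {d : ℕ} {g : A⟦X⟧}
    (hL : ∀ F, X ^ 2 * d⁄dX 𝕜 (seriesAct L F) = seriesAct L (strongIntegrand 𝕜 d Φ g F))
    (hL' : ∀ F, X ^ 2 * d⁄dX 𝕜 (seriesAct L' F) = seriesAct L' (strongIntegrand 𝕜 d Φ g F))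
    (hone : L 0 1 ≠ 0) {c : 𝕜⟦X⟧} (hc : ∀ F, seriesAct L' F = c * seriesAct L F) :
    L' = coeff 0 c • L := by
  have hne : seriesAct L 1 ≠ 0 := fun h => hone (by
    rw [← PowerSeries.coeff_zero_one, ← coeff_zero_seriesAct, h, map_zero])
  have derivative_c : d⁄dX 𝕜 c = 0 := by
    have leibniz := hL' 1
    rw [hc, hc, ← hL, Derivation.leibniz, smul_eq_mul, smul_eq_mul] at leibniz
    have : X ^ 2 * (seriesAct L 1 * d⁄dX 𝕜 c) = 0 := by linear_combination leibniz
    simpa [hne] using this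
  have c_eq : c = C (coeff 0 c) := PowerSeries.derivative.ext
    (by rw [derivative_c, PowerSeries.derivative_C]) (by simp)
  ext r f
  rw [← coeff_seriesAct_C L', hc, c_eq, PowerSeries.coeff_C_mul, coeff_seriesAct_C,
    PowerSeries.coeff_zero_C]
  rfl

end SeriesActionUniqueness

section Uniqueness

variable {n : ℕ} {M : Type*} [TopologicalSpace M] [ChartedSpace (EuclideanSpace ℝ (Fin n)) M]

theorem IsPointDistribution.smul {x₀ : M} {L : SmoothFun n M →ₗ[ℂ] ℂ}
    (h : IsPointDistribution x₀ L) (c : ℂ) : IsPointDistribution x₀ (c • L) := by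
  obtain ⟨S, N, B, hS, hS', hB⟩ := h.continuous
  refine ⟨fun f hf => by rw [LinearMap.smul_apply, h.support f hf, smul_zero],
    S, N, ‖c‖ * B, hS, hS', fun f b hb hfb => ?_⟩
  rw [LinearMap.smul_apply, norm_smul, mul_assoc]
  exact mul_le_mul_of_nonneg_left (hB f b hb hfb) (norm_nonneg c)

variable [IsManifold (𝓡 n) ∞ M] {x₀ : M} {φ : (SmoothFun n M)⸨X⸩} {ρ : ℕ → TopForm n M}
  {L L' : FormalFunctional n M}

theorem IsStrongFOI.smul (hφ : IsFormalPhase x₀ φ) (h : IsStrongFOI x₀ φ ρ L) {c : ℂ}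
    (hc : c ≠ 0) : IsStrongFOI x₀ φ ρ (c • L) := by
  rw [isStrongFOI_iff hφ] at h ⊢
  obtain ⟨distribution, leading_ne_zero, integration_by_parts, differentiation⟩ := h
  refine ⟨fun r => (distribution r).smul c, smul_ne_zero hc leading_ne_zero,
    fun v g hg F => ?_, fun g hg F => ?_⟩
  · rw [seriesAct_smul, integration_by_parts v g hg, smul_zero]
  · rw [seriesAct_smul, seriesAct_smul, ← differentiation g hg, ← mul_smul_comm,
      Derivation.map_smul]

variable [T2Space M]

theorem IsStrongFOI.exists_eq_smul (hφ : IsFormalPhase x₀ φ) (hρ : (ρ 0).form x₀ ≠ 0)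
    (h : IsStrongFOI x₀ φ ρ L) (h' : IsStrongFOI x₀ φ ρ L') (hone : L 0 1 ≠ 0) :
    ∃ c : ℂ, c ≠ 0 ∧ L' = c • L := by
  obtain ⟨distribution, -, integration_by_parts, differentiation⟩ := (isStrongFOI_iff hφ ρ L).1 h
  obtain ⟨distribution', leading_ne_zero', integration_by_parts', differentiation'⟩ :=
    (isStrongFOI_iff hφ ρ L').1 h'
  choose g hg using fun k => exists_isDivergence_frame (n := n) hρ k
  obtain ⟨u, hu⟩ := exists_isLogDerivative hρ
  have decomposition (f : SmoothFun n M) : ∃ (a : ℂ) (h : Fin n → SmoothFun n M),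
      f - (algebraMap ℂ (SmoothFun n M) a + ∑ k, vfDer (frame x₀ k) (coeff 0 (phaseSeries φ)) * h k)
        ∈ germIdeal n x₀ := by
    rw [coeff_zero_phaseSeries]
    exact ⟨_, hφ.critical.exists_eq_sum_frame_mul f⟩
  obtain ⟨c, hc⟩ := exists_seriesAct_eq_mul (D := fun k => vfDer (frame x₀ k)) (g := g)
    decomposition (fun r f hf => (distribution r).support f hf)
    (fun r f hf => (distribution' r).support f hf)
    (fun k => integration_by_parts _ _ (hg k)) (fun k => integration_by_parts' _ _ (hg k)) hone
  have eq_smul : L' = coeff 0 c • L := eq_smul_of_seriesAct_strongIntegrand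
    (differentiation u hu) (differentiation' u hu) hone hc
  refine ⟨coeff 0 c, fun c_eq_zero => leading_ne_zero' ?_, eq_smul⟩
  rw [eq_smul, c_eq_zero, zero_smul, Pi.zero_apply]

end Uniqueness

section Annihilators

variable {𝕜 ι A : Type*} [Field 𝕜] [Fintype ι] [CommRing A] [Algebra 𝕜 A]
  {K : FormalFrame 𝕜 ι A}

theorem taylor_sub_algebraMap_ev_eq_zero {f : A} (hf : ∀ i, taylor K (K.der i f) = 0) :
    taylor K (f - algebraMap 𝕜 A (K.ev f)) = 0 := by
  ext1 d
  rw [coeff_taylor, map_zero]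
  cases d with
  | zero => simp [taylorCoeff_zero]
  | succ d =>
    have (i : ι) : taylorCoeff K d (K.der i f) = 0 := by
      rw [← coeff_taylor, hf, map_zero]
    simp [taylorCoeff_succ, this]

theorem assocIntegrand_mul (D : Derivation 𝕜 A A) (Φ g H F : A⟦X⟧) :
    assocIntegrand D Φ g (H * F)
      = X * (seriesDer D H * F) + H * assocIntegrand D Φ g F := by
  rw [assocIntegrand, assocIntegrand, Derivation.leibniz, smul_eq_mul, smul_eq_mul]
  ring

variable {L : ℕ → A →ₗ[𝕜] 𝕜} {c : 𝕜} {Φ : A⟦X⟧} {g : ι → A⟦X⟧}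

-- Integration by parts shows that with `H` also each `∂ᵢ H` annihilates `L`.
theorem taylor_coeff_zero_eq_zero_of_seriesAct_mul (hc : c ≠ 0)
    (leading : L 0 = c • K.ev.toLinearMap)
    (hL : ∀ i F, seriesAct L (assocIntegrand (K.der i) Φ (g i) F) = 0) {H : A⟦X⟧}
    (hH : ∀ F, seriesAct L (H * F) = 0) : taylor K (coeff 0 H) = 0 := by
  ext1 d
  rw [coeff_taylor, map_zero]
  induction d generalizing H with
  | zero =>
    have ev_eq_zero : c • K.ev (coeff 0 H) = 0 := by
      have := congrArg (coeff 0) (hH 1)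
      rwa [mul_one, coeff_zero_seriesAct, leading, map_zero] at this
    rw [taylorCoeff_zero, (smul_eq_zero.1 ev_eq_zero).resolve_left hc, map_zero]
  | succ d ih =>
    have seriesDer_mul (i : ι) (F : A⟦X⟧) : seriesAct L (seriesDer (K.der i) H * F) = 0 := by
      have := hL i (H * F)
      rw [assocIntegrand_mul, map_add, hH, add_zero, seriesAct_X_mul] at this
      exact (mul_eq_zero.1 this).resolve_left PowerSeries.X_ne_zero
    have (i : ι) : taylorCoeff K d (K.der i (coeff 0 H)) = 0 := by
      rw [← coeff_seriesDer]
      exact ih (seriesDer_mul i)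
    simp only [taylorCoeff_succ, this, mul_zero, Finset.sum_const_zero, smul_zero]

variable [CharZero 𝕜]

theorem taylor_der_eq_zero {f : A} (hf : taylor K f = 0) (i : ι) : taylor K (K.der i f) = 0 := by
  have h := seriesDer_taylor K i f
  rw [hf, map_zero] at h
  exact (mul_eq_zero.1 h.symm).resolve_left PowerSeries.X_ne_zero

theorem taylor_coeff_eq_zero_of_seriesAct_mul (hc : c ≠ 0) (leading : L 0 = c • K.ev.toLinearMap)
    (hnull : ∀ r f, taylor K f = 0 → L r f = 0)
    (hL : ∀ i F, seriesAct L (assocIntegrand (K.der i) Φ (g i) F) = 0) {H : A⟦X⟧}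
    (hH : ∀ F, seriesAct L (H * F) = 0) (k : ℕ) : taylor K (coeff k H) = 0 := by
  have taylor_zero {H : A⟦X⟧} (hH : ∀ F, seriesAct L (H * F) = 0) :=
    taylor_coeff_zero_eq_zero_of_seriesAct_mul hc leading hL hH
  induction k generalizing H with
  | zero => exact taylor_zero hH
  | succ k ih =>
    rw [← coeff_shift]
    refine ih fun F => ?_
    have leading_mul : seriesAct L (C (coeff 0 H) * F) = 0 := by
      ext1 r
      rw [coeff_seriesAct, map_zero]
      refine Finset.sum_eq_zero fun p _ => hnull _ _ ?_
      rw [PowerSeries.coeff_C_mul, taylor_mul, taylor_zero hH, zero_mul]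
    have := hH F
    rw [eq_C_add_X_mul_shift H, add_mul, map_add, leading_mul, zero_add, mul_assoc,
      seriesAct_X_mul] at this
    exact (mul_eq_zero.1 this).resolve_left PowerSeries.X_ne_zero

theorem taylor_coeff_sub_C_mul_X_eq_zero {G : A⟦X⟧}
    (hder : ∀ i k, taylor K (coeff k (seriesDer (K.der i) G)) = 0)
    (heuler : ∀ k, taylor K (coeff k (X * d⁄dX A G - G)) = 0) (k : ℕ) :
    taylor K (coeff k (G - C (algebraMap 𝕜 A (K.ev (coeff 1 G))) * X)) = 0 := by
  rw [map_sub, PowerSeries.coeff_C_mul, PowerSeries.coeff_X]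
  split_ifs with hk
  · subst hk
    rw [mul_one]
    exact taylor_sub_algebraMap_ev_eq_zero fun i => by rw [← coeff_seriesDer, hder]
  · have coeff_euler : coeff k (X * d⁄dX A G - G)
        = algebraMap 𝕜 A ((k : 𝕜) - 1) * coeff k G := by
      rw [← eulerSeries_apply, map_sub, coeff_eulerSeries, map_sub (algebraMap 𝕜 A), map_natCast,
        map_one]
      ring
    have ne_zero : (k : 𝕜) - 1 ≠ 0 := sub_ne_zero.2 (by exact_mod_cast hk)
    have := heuler k
    rw [coeff_euler, taylor_mul, taylor_algebraMap] at this
    rw [mul_zero, sub_zero]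
    refine (mul_eq_zero.1 this).resolve_left ?_
    exact (map_ne_zero_iff _ PowerSeries.C_injective).2
      ((map_ne_zero_iff _ (MvPolynomial.C_injective _ _)).2 ne_zero)

end Annihilators

section Jets

variable {n : ℕ} {M : Type*} [TopologicalSpace M] [ChartedSpace (EuclideanSpace ℝ (Fin n)) M]
  [IsManifold (𝓡 n) ∞ M] [T2Space M] {x₀ : M}

theorem jetVanishes_of_taylor_eq_zero {f : SmoothFun n M}
    (hf : taylor (pointFrame x₀) f = 0) : JetVanishes x₀ f := by
  intro m
  induction m generalizing f with
  | zero =>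
    have ev_eq_zero : (f : M → ℂ) x₀ = 0 := by
      have := congrArg (coeff 0) hf
      rwa [coeff_taylor, taylorCoeff_zero, map_zero,
        map_eq_zero_iff _ (MvPolynomial.C_injective _ _)] at this
    ext v
    rw [iteratedFDeriv_zero_apply, inChart_extChartAt (mem_extChartAt_source x₀), ev_eq_zero]
    rfl
  | succ m ih =>
    have contDiffAt_fderiv :
        ContDiffAt ℝ ∞ (fderiv ℝ (inChart (n := n) x₀ f)) (extChartAt (𝓡 n) x₀ x₀) :=
      (contDiffAt_inChart x₀ f (mem_extChartAt_target x₀)).fderiv_right (by simp)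
    have partial_eq_zero (i : Fin n) (w : Fin m → EuclideanSpace ℝ (Fin n)) :
        iteratedFDeriv ℝ m (fderiv ℝ (inChart (n := n) x₀ f)) (extChartAt (𝓡 n) x₀ x₀) w
          (EuclideanSpace.single i 1) = 0 := by
      have jet_frame : iteratedFDeriv ℝ m (inChart (n := n) x₀ (vfApply (frame x₀ i) f))
          (extChartAt (𝓡 n) x₀ x₀) = 0 := ih (taylor_der_eq_zero hf i)
      rw [((inChart_vfApply_frame_eventuallyEq (mem_frameDomain n x₀) i f).iteratedFDeriv ℝ
        m).self_of_nhds] at jet_frame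
      have comp_apply := (ContinuousLinearMap.apply ℝ ℂ
        (EuclideanSpace.single i (1 : ℝ))).iteratedFDeriv_comp_left contDiffAt_fderiv
          (WithTop.coe_le_coe.2 (le_top : (m : ℕ∞) ≤ ⊤))
      exact (congrArg (fun T => T w) (jet_frame.symm.trans comp_apply)).symm
    ext v
    rw [iteratedFDeriv_succ_apply_right,
      show iteratedFDeriv ℝ m (fderiv ℝ (inChart (n := n) x₀ f)) (extChartAt (𝓡 n) x₀ x₀)
        (Fin.init v) = 0 from ContinuousLinearMap.coe_injective
          ((stdBasis n).ext fun i => by simpa [stdBasis] using partial_eq_zero i _)]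
    rfl

variable {φ φ' : (SmoothFun n M)⸨X⸩} {ρ : ℕ → TopForm n M} {L : FormalFunctional n M}

theorem jetIsConst_sub (hφ : IsFormalPhase x₀ φ) (hφ' : IsFormalPhase x₀ φ') {a : ℂ}
    (h : ∀ k, taylor (pointFrame x₀) (coeff k
      (phaseSeries φ - phaseSeries φ' - C (algebraMap ℂ (SmoothFun n M) a) * X)) = 0) :
    JetIsConst x₀ (φ - φ') a := by
  refine fun k => jetVanishes_of_taylor_eq_zero ?_
  rcases lt_or_ge k (-1) with hk | hk
  · rw [HahnSeries.coeff_sub, HahnSeries.coeff_sub, hφ.coeff_eq_zero k hk,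
      hφ'.coeff_eq_zero k hk, HahnSeries.C_apply, HahnSeries.coeff_single, if_neg (by omega),
      sub_self, sub_zero, map_zero]
  · obtain ⟨j, hj⟩ := Int.eq_ofNat_of_zero_le (show 0 ≤ k + 1 by omega)
    obtain rfl : k = j - 1 := by omega
    convert h j using 2
    rw [HahnSeries.coeff_sub, HahnSeries.coeff_sub, HahnSeries.C_apply, HahnSeries.coeff_single,
      map_sub, map_sub, phaseSeries, phaseSeries, PowerSeries.coeff_mk, PowerSeries.coeff_mk,
      PowerSeries.coeff_C_mul, PowerSeries.coeff_X, mul_ite, mul_one, mul_zero]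
    congr 1
    split_ifs <;> first | rfl | omega

theorem exists_isStrongFOI_zero_eq_dirac (hφ : IsFormalPhase x₀ φ) (hρ : (ρ 0).form x₀ ≠ 0) :
    ∃ L : FormalFunctional n M, IsStrongFOI x₀ φ ρ L ∧ L 0 = dirac x₀ ∧
      ∀ r f, taylor (pointFrame x₀) f = 0 → L r f = 0 := by
  have density_ne := density_ne_zero hρ
  refine ⟨((density x₀ (ρ 0) : M → ℂ) x₀)⁻¹ • stationaryPhase x₀ φ ρ,
    (isStrongFOI_stationaryPhase hφ hρ).smul hφ (inv_ne_zero density_ne), ?_, fun r f hf => ?_⟩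
  · rw [Pi.smul_apply, stationaryPhase_zero, inv_smul_smul₀ density_ne]
  · rw [Pi.smul_apply, LinearMap.smul_apply, stationaryPhase_eq_zero hf, smul_zero]

theorem IsStrongFOI.exists_jetIsConst_sub (hφ : IsFormalPhase x₀ φ) (hφ' : IsFormalPhase x₀ φ')
    (hρ : (ρ 0).form x₀ ≠ 0) (h : IsStrongFOI x₀ φ ρ L) (h' : IsStrongFOI x₀ φ' ρ L) {c : ℂ}
    (hc : c ≠ 0) (leading : L 0 = c • dirac x₀)
    (hnull : ∀ r f, taylor (pointFrame x₀) f = 0 → L r f = 0) :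
    ∃ a, JetIsConst x₀ (φ - φ') a := by
  obtain ⟨-, -, integration_by_parts, differentiation⟩ := (isStrongFOI_iff hφ ρ L).1 h
  obtain ⟨-, -, integration_by_parts', differentiation'⟩ := (isStrongFOI_iff hφ' ρ L).1 h'
  choose g hg using fun k => exists_isDivergence_frame (n := n) hρ k
  obtain ⟨u, hu⟩ := exists_isLogDerivative hρ
  have taylor_eq_zero {H : (SmoothFun n M)⟦X⟧} (hH : ∀ F, seriesAct L (H * F) = 0) (k : ℕ) :
      taylor (pointFrame x₀) (coeff k H) = 0 :=
    taylor_coeff_eq_zero_of_seriesAct_mul hc leading hnull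
      (fun i => integration_by_parts _ _ (hg i)) hH k
  refine ⟨_, jetIsConst_sub hφ hφ' (taylor_coeff_sub_C_mul_X_eq_zero
    (fun i => taylor_eq_zero fun F => ?_) (taylor_eq_zero fun F => ?_))⟩
  · have := sub_eq_zero.2
      ((integration_by_parts _ _ (hg i) F).trans (integration_by_parts' _ _ (hg i) F).symm)
    rw [← map_sub] at this
    convert this using 2
    change seriesDer (vfDer (frame x₀ i)) _ * F = _
    rw [assocIntegrand, assocIntegrand, map_sub]
    ring
  · have := sub_eq_zero.2 ((differentiation u hu F).symm.trans (differentiation' u hu F))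
    rw [← map_sub] at this
    convert this using 2
    rw [strongIntegrand, strongIntegrand, map_sub]
    ring

end Jets

end FOI

end

theorem mainTheorem1_general (n : ℕ) (M : Type*) [TopologicalSpace M] [T2Space M]
    [ChartedSpace (EuclideanSpace ℝ (Fin n)) M] [IsManifold (𝓡 n) ∞ M] (x₀ : M)
    (φ : LaurentSeries (FOI.SmoothFun n M)) (hφ : FOI.IsFormalPhase x₀ φ)
    (ρ : ℕ → FOI.TopForm n M) (hρ : (ρ 0).form x₀ ≠ 0) :
    (∃ Λ : FOI.FormalFunctional n M, FOI.IsStrongFOI x₀ φ ρ Λ) ∧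
    (∀ Λ : FOI.FormalFunctional n M, FOI.IsStrongFOI x₀ φ ρ Λ →
      ∀ Λ' : FOI.FormalFunctional n M,
        FOI.IsStrongFOI x₀ φ ρ Λ' ↔ ∃ c : ℂ, c ≠ 0 ∧ Λ' = c • Λ) ∧
    (∃! Λ : FOI.FormalFunctional n M, FOI.IsStrongFOI x₀ φ ρ Λ ∧ Λ 0 = FOI.dirac x₀) ∧
    (∀ Λ : FOI.FormalFunctional n M, FOI.IsStrongFOI x₀ φ ρ Λ →
      ∀ φ' : LaurentSeries (FOI.SmoothFun n M), FOI.IsFormalPhase x₀ φ' →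
        FOI.IsStrongFOI x₀ φ' ρ Λ → ∃ c : ℂ, FOI.JetIsConst x₀ (φ - φ') c) := by
  obtain ⟨L, hL, leading, hnull⟩ := FOI.exists_isStrongFOI_zero_eq_dirac hφ hρ
  have dirac_one : FOI.dirac (n := n) x₀ 1 = 1 := rfl
  have exists_eq_smul (Λ) (hΛ : FOI.IsStrongFOI x₀ φ ρ Λ) : ∃ c : ℂ, c ≠ 0 ∧ Λ = c • L :=
    hL.exists_eq_smul hφ hρ hΛ (by rw [leading, dirac_one]; exact one_ne_zero)
  refine ⟨⟨L, hL⟩, fun Λ hΛ Λ' => ⟨fun hΛ' => ?_, ?_⟩, ⟨L, ⟨hL, leading⟩, ?_⟩, ?_⟩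
  · obtain ⟨c, hc, rfl⟩ := exists_eq_smul Λ hΛ
    obtain ⟨c', hc', rfl⟩ := exists_eq_smul Λ' hΛ'
    exact ⟨c' / c, div_ne_zero hc' hc, by rw [smul_smul, div_mul_cancel₀ _ hc]⟩
  · rintro ⟨c, hc, rfl⟩
    exact hΛ.smul hφ hc
  · rintro Λ ⟨hΛ, leading'⟩
    obtain ⟨c, -, rfl⟩ := exists_eq_smul Λ hΛ
    obtain rfl : c = 1 := by
      simpa [leading, dirac_one] using LinearMap.congr_fun leading' 1
    exact one_smul ℂ L
  · intro Λ hΛ φ' hφ' hΛ'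
    obtain ⟨c, hc, rfl⟩ := exists_eq_smul Λ hΛ
    exact hΛ.exists_jetIsConst_sub hφ hφ' hρ hΛ' hc (by rw [Pi.smul_apply, leading])
      fun r f hf => by rw [Pi.smul_apply, LinearMap.smul_apply, hnull r f hf, smul_zero]

theorem mainTheorem1 (n : ℕ) (M : Type*) [TopologicalSpace M] [T2Space M]
    [SecondCountableTopology M] [ChartedSpace (EuclideanSpace ℝ (Fin n)) M]
    [IsManifold (𝓡 n) ∞ M] (x₀ : M)
    (φ : LaurentSeries (FOI.SmoothFun n M)) (hφ : FOI.IsFormalPhase x₀ φ)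
    (ρ : ℕ → FOI.TopForm n M) (hρ : (ρ 0).form x₀ ≠ 0) :
    (∃ Λ : FOI.FormalFunctional n M, FOI.IsStrongFOI x₀ φ ρ Λ) ∧
    (∀ Λ : FOI.FormalFunctional n M, FOI.IsStrongFOI x₀ φ ρ Λ →
      ∀ Λ' : FOI.FormalFunctional n M,
        FOI.IsStrongFOI x₀ φ ρ Λ' ↔ ∃ c : ℂ, c ≠ 0 ∧ Λ' = c • Λ) ∧
    (∃! Λ : FOI.FormalFunctional n M, FOI.IsStrongFOI x₀ φ ρ Λ ∧ Λ 0 = FOI.dirac x₀) ∧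
    (∀ Λ : FOI.FormalFunctional n M, FOI.IsStrongFOI x₀ φ ρ Λ →
      ∀ φ' : LaurentSeries (FOI.SmoothFun n M), FOI.IsFormalPhase x₀ φ' →
        FOI.IsStrongFOI x₀ φ' ρ Λ → ∃ c : ℂ, FOI.JetIsConst x₀ (φ - φ') c) :=
  mainTheorem1_general n M x₀ φ hφ ρ hρ
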